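/- **Wilson loop diagrams.** Label the vertices and edges of a hexagon cyclically by $1,\dots,6$, counterclockwise, edge $e$ joining the vertices $e$ and $e+1$ (indices mod 6). A Wilson loop diagram $W$ with $2$ propagators consists of two pairs of edges $p_b=(i_b,j_b)$, $i_b<j_b$, $b=1,2$, listed in the order in which they are met when walking counterclockwise from vertex $1$; propagators sharing an edge are drawn so that they do not cross because of it. The support of $p=(i,j)$ is $V_p=\{i,i+1,j,j+1\}$. $W$ is admissible if $|\bigcup_{p\in Q}V_p|\ge |Q|+3$ for every non-empty set $Q$ of its propagators and no two propagators cross. Let $\mathcal C(W)$ be the $2\times 6$ matrix with independent indeterminates $c_{b,a}$ at the places with $a\in V_{p_b}$ and $0$ elsewhere, and let $\Sigma(W)$ be the closure, in the totally nonnegative Grassmannian $\mathbb G_{\mathbb R,\ge0}(2,6)$, of the positroid cell whose bases are the maximal minors of $\mathcal C(W)$ that are not identically zero. **Boundary diagrams.** For a propagator $p$ of $W$ and $v\in V_p$, move the end of $p$ lying on the edge with end point $v$ away from $v$ along that edge, until either (i) it reaches the other end point of the edge, or (ii) it touches the end of another propagator $q$ on that edge. The result is the boundary diagram $\partial_{p,v}(W)$;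 the two ways in which the same two neighbouring ends can be brought to touch give the same boundary diagram. Put $\Delta_{p,v}(W)=c_{p,v}$ in case (i), and in case (ii), on edge $e$, with $p$ nearer to the vertex $e$ than $q$, $\Delta_{p,v}(W)=c_{p,e}c_{q,e+1}-c_{q,e}c_{p,e+1}$. The positroid of $\partial_{p,v}(W)$ has as bases the maximal minors that do not vanish identically on the matrices of the shape of $\mathcal C(W)$ with $\Delta_{p,v}(W)=0$; write $\partial_{p,v}(W)=\Sigma'$ if it is the positroid of the cell $\Sigma'$. **Integrals.** Let $Z_1,\dots,Z_6\in\mathbb R^4$ (twistor components) be in general position, i.e. $\langle abcd\rangle=\det(Z_a,Z_b,Z_c,Z_d)\neq0$ for distinct $a,b,c,d$, and let $Z_*\in\mathbb R^4$ be a gauge vector (its fermionic components are $0$). Let $V$ be a real vector space and $\eta_i^A,\varphi_b^A\in V$ ($1\le i\le 6$, $b=1,2$, $1\le A\le4$), regarded as anticommuting elements of the exterior algebra $\Lambda V$; the bosonized fermionic components are $Z_i^{4+b}=\sum_{A=1}^4\varphi_b^A\eta_i^A\in\Lambda V$. For an edge $e$ with incident propagators $q_1,\dots,q_s$, ordered from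 vertex $e$ to vertex $e+1$, put $$R_e(W)=c_{q_1,e+1}\,c_{q_s,e}\prod_{m=1}^{s-1}(c_{q_m,e}c_{q_{m+1},e+1}-c_{q_{m+1},e}c_{q_m,e+1}),$$ and let $R(W)$ be the product of the $R_e(W)$ over all edges $e$ carrying a propagator; its factors are exactly the $\Delta_{p,v}(W)$, one for each boundary diagram. The integral $$\mathcal I(W)(Z_*)=\int \frac{\prod_{b}\prod_{a\in V_{p_b}}dc_{b,a}}{R(W)}\prod_{b=1}^2\Big(\sum_{a\in V_{p_b}} c_{b,a}Z_a^{4+b}\Big)^4\delta^4\Big(Z_*+\sum_{a\in V_{p_b}} c_{b,a}Z_a\Big)$$ is evaluated by the rule $\int f(c)\,\delta^4(z+cM)\,d^4c=f(-zM^{-1})/\det M$, that is, $$\mathcal I(W)(Z_*)=\prod_{b=1}^2\frac1{\langle i_b\,(i_b{+}1)\,j_b\,(j_b{+}1)\rangle}\cdot\left.\frac{\prod_{b=1}^2\big(\sum_{a\in V_{p_b}} c_{b,a}Z_a^{4+b}\big)^4}{R(W)}\right|_{\,Z_*+\sum_{a\in V_{p_b}} c_{b,a}Z_a=0\ (b=1,2)}\in\Lambda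 V .$$ **Theorem.** Let $W$ be an admissible Wilson loop diagram with $2$ propagators and $6$ external particles, and let $\Sigma'$ be any $5$-dimensional positroid cell contained in the boundary of $\Sigma(W)$. Consider all pairs of an admissible diagram $W'$ with $2$ propagators and $6$ external particles and a boundary diagram $\partial_{p,v}(W')$ of it with $\partial_{p,v}(W')=\Sigma'$. Let $t\mapsto Z_*(t)=z+tu$ be any line of gauge vectors such that for each of these pairs, with $R(W')$ and its factors evaluated at $Z_*(t)$ as above, no factor of $R(W')$ other than $\Delta_{p,v}(W')$ vanishes at $t=0$, and $\Delta_{p,v}(W')$, if it vanishes at $t=0$, does so to first order in $t$. Then each $\mathcal I(W')(Z_*(t))$ has at most a simple pole at $t=0$, and $$\sum_{\substack{W'\text{ admissible},\\ \partial_{p,v}(W')=\Sigma'}}\operatorname{Res}_{t=0}\ \mathcal I(W')(Z_*(t))=0 .$$ -/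

import Mathlib

open Filter Topology

namespace WilsonLoop

/-! ### Wilson loop diagrams

The vertices and the edges of the `n`-gon are both indexed by `Fin n`; edge `e` joins the vertices
`e` and `e + 1` (addition is cyclic), in counterclockwise order. -/

/-- A propagator, given by the pair of edges that it joins. -/
abbrev Propagator (n : ℕ) : Type := Fin n × Fin n

/-- The `k` propagators `p_1, …, p_k` of a diagram with `n` external particles, in order. -/
abbrev Diagram (k n : ℕ) : Type := Fin k → Propagator n

section Diagrams

variable {k n : ℕ} [NeZero n]

/-- The support `V_p` of a propagator: the end points of the two edges that it touches. -/
def support (p : Propagator n) : Finset (Fin n) := {p.1, p.1 + 1, p.2, p.2 + 1}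

/-- Every propagator is written `(i, j)` with `i < j`, and the propagators are listed in the order
in which they are first met when walking counterclockwise from the vertex `0` (of two propagators
that start on the same edge, the one with the larger other end is nearer to the first vertex of that
edge). In this way each diagram is represented by exactly one list. -/
def IsWLD (W : Diagram k n) : Prop :=
  (∀ b, (W b).1 < (W b).2) ∧
  ∀ a b, a < b → (W a).1 < (W b).1 ∨ ((W a).1 = (W b).1 ∧ (W b).2 < (W a).2)

/-- Two propagators cross if their ends interlace (propagators that share an edge are drawn
without a crossing). -/
def Crosses (p q : Propagator n) : Prop :=
  (p.1 < q.1 ∧ q.1 < p.2 ∧ p.2 < q.2) ∨ (q.1 < p.1 ∧ p.1 < q.2 ∧ q.2 < p.2)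

/-- Admissible Wilson loop diagrams. -/
def Admissible (W : Diagram k n) : Prop :=
  IsWLD W ∧
  k + 4 ≤ n ∧
  (∀ Q : Finset (Fin k), Q.Nonempty → Q.card + 3 ≤ (Q.biUnion fun b => support (W b)).card) ∧
  ∀ a b, ¬ Crosses (W a) (W b)

instance (W : Diagram k n) : Decidable (Admissible W) := by
  unfold Admissible IsWLD Crosses
  infer_instance

/-- The propagator `p_b` has an end on the edge `e`. -/
abbrev Incident (W : Diagram k n) (e : Fin n) (b : Fin k) : Prop := (W b).1 = e ∨ (W b).2 = e

/-- The other edge of a propagator with an end on `e`. -/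
def otherEdge (e : Fin n) (p : Propagator n) : Fin n := if p.1 = e then p.2 else p.1

/-- On the edge `e`, the end of `p_a` is nearer to the vertex `e` than the end of `p_b`: in the
drawing without crossings this holds when the other end of `p_a` is further away from `e` in
counterclockwise direction. -/
abbrev Before (W : Diagram k n) (e : Fin n) (a b : Fin k) : Prop :=
  Incident W e a ∧ Incident W e b ∧ otherEdge e (W b) - e < otherEdge e (W a) - e

/-- `p_a` is the propagator on the edge `e` that is nearest to the vertex `e`. -/
abbrev IsFirst (W : Diagram k n) (e : Fin n) (a : Fin k) : Prop :=
  Incident W e a ∧ ∀ b, ¬ Before W e b a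

/-- `p_a` is the propagator on the edge `e` that is nearest to the vertex `e + 1`. -/
abbrev IsLast (W : Diagram k n) (e : Fin n) (a : Fin k) : Prop :=
  Incident W e a ∧ ∀ b, ¬ Before W e a b

/-- `p_b` is the neighbour of `p_a` on the edge `e`, on the side of the vertex `e + 1`. -/
abbrev Consecutive (W : Diagram k n) (e : Fin n) (a b : Fin k) : Prop :=
  Before W e a b ∧ ∀ c, ¬ (Before W e a c ∧ Before W e c b)

end Diagrams

/-! ### Boundary diagrams -/

/-- What happens to a diagram at the end of a propagator move: either `p_b` loses the vertex `v`
from its support (`leave b v`), or the ends of the propagators `p_a` and `p_b`, which are neighbours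
on the edge `e` with `p_a` nearer to `e`, come to touch (`touch e a b`). A diagram together with
such a datum is a boundary diagram; the same `touch e a b` arises when `p_a` moves towards `p_b` and
when `p_b` moves towards `p_a`. -/
inductive Move (k n : ℕ) : Type
  | leave (b : Fin k) (v : Fin n) : Move k n
  | touch (e : Fin n) (a b : Fin k) : Move k n
  deriving DecidableEq, Fintype

section Boundaries

variable {k n : ℕ} [NeZero n]

/-- `D` describes the boundary diagram `∂_{p,v}(W)` for `p = p_b`: the end of `p_b` that lies on the
edge `e` of which `v` is an end point moves away from `v`, until it meets the next propagator on `e`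
or, if there is none, the other vertex of `e`. -/
abbrev IsBoundary (W : Diagram k n) (b : Fin k) (v : Fin n) (D : Move k n) : Prop :=
  ∃ e, Incident W e b ∧
    ((v = e ∧ ((∃ a, Consecutive W e b a ∧ D = .touch e b a) ∨
        (IsLast W e b ∧ D = .leave b v))) ∨
     (v = e + 1 ∧ ((∃ a, Consecutive W e a b ∧ D = .touch e a b) ∨
        (IsFirst W e b ∧ D = .leave b v))))

set_option synthInstance.maxSize 2000 in
set_option synthInstance.maxHeartbeats 200000 in
instance (W : Diagram k n) (b : Fin k) (v : Fin n) (D : Move k n) : Decidable (IsBoundary W b v D) :=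
  inferInstance

/-- The distinct boundary diagrams `∂_{p,v}(W)`, for `p` a propagator of `W` and `v ∈ V_p`. -/
def boundaries (W : Diagram k n) : Finset (Move k n) :=
  Finset.univ.filter fun D => ∃ b, ∃ v ∈ support (W b), IsBoundary W b v D

/-- The minor `Δ_{p,v}(W)` of a `k × n` matrix that vanishes on the boundary diagram. -/
def Move.delta (D : Move k n) (C : Matrix (Fin k) (Fin n) ℝ) : ℝ :=
  match D with
  | .leave b v => C b v
  | .touch e a b => C a e * C b (e + 1) - C b e * C a (e + 1)

end Boundaries

/-! ### The nonnegative Grassmannian and its positroid cells -/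

/-- Real `k × n` matrices of full rank. -/
abbrev FullRank (k n : ℕ) : Type := {A : Matrix (Fin k) (Fin n) ℝ // LinearIndependent ℝ A.row}

/-- Two matrices are identified if they differ by the left action of `GL_k(ℝ)`. -/
def rowEquiv (k n : ℕ) : Setoid (FullRank k n) where
  r A B := ∃ g : GL (Fin k) ℝ, (B : Matrix (Fin k) (Fin n) ℝ) =
    (g : Matrix (Fin k) (Fin k) ℝ) * (A : Matrix (Fin k) (Fin n) ℝ)
  iseqv :=
    { refl := fun A => ⟨1, by simp⟩
      symm := by
        rintro A B ⟨g, hg⟩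
        refine ⟨g⁻¹, ?_⟩
        rw [hg, ← Matrix.mul_assoc, ← Units.val_mul, inv_mul_cancel, Units.val_one,
          Matrix.one_mul]
      trans := by
        rintro A B C ⟨g, hg⟩ ⟨h, hh⟩
        exact ⟨h * g, by rw [hh, hg, Units.val_mul, Matrix.mul_assoc]⟩ }

/-- The real Grassmannian, with its quotient topology. -/
def Grassmannian (k n : ℕ) : Type := Quotient (rowEquiv k n)

instance (k n : ℕ) : TopologicalSpace (Grassmannian k n) :=
  inferInstanceAs (TopologicalSpace (Quotient (rowEquiv k n)))

/-- The maximal minor `Δ_I`; the `k`-subset `I` is given by its increasing enumeration. -/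
def maxMinor {k n : ℕ} (A : Matrix (Fin k) (Fin n) ℝ) (I : Fin k ↪o Fin n) : ℝ :=
  (A.submatrix id I).det

/-- The set of totally nonnegative points whose nonzero maximal minors are those in `B`. -/
def positroidCell {k n : ℕ} (B : Set (Fin k ↪o Fin n)) : Set (Grassmannian k n) :=
  {x | ∃ A : FullRank k n, Quotient.mk (rowEquiv k n) A = x ∧
    (∀ I, 0 ≤ maxMinor A.1 I) ∧ ∀ I, maxMinor A.1 I ≠ 0 ↔ I ∈ B}

/-- `B` is the set of bases of a positroid. -/
def IsPositroid {k n : ℕ} (B : Set (Fin k ↪o Fin n)) : Prop := (positroidCell B).Nonempty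

/-- The cell of `B` is homeomorphic to an open ball of dimension `d`. -/
def CellHasDim {k n : ℕ} (B : Set (Fin k ↪o Fin n)) (d : ℕ) : Prop :=
  Nonempty (positroidCell B ≃ₜ EuclideanSpace ℝ (Fin d))

section Cells

variable {k n : ℕ} [NeZero n]

/-- `C` is a specialization of the matrix `𝒞(W)` of indeterminates. -/
def HasShape (W : Diagram k n) (C : Matrix (Fin k) (Fin n) ℝ) : Prop :=
  ∀ b a, a ∉ support (W b) → C b a = 0

/-- The bases of the matroid defined by `𝒞(W)`: the maximal minors of this matrix of indeterminates
that are not identically zero. -/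
def bases (W : Diagram k n) : Set (Fin k ↪o Fin n) :=
  {I | ∃ C, HasShape W C ∧ maxMinor C I ≠ 0}

/-- The bases of the matroid defined by the boundary matrix `𝒞(∂_{p,v}(W))`, in which the entries are
indeterminates subject to `Δ_{p,v}(W) = 0`. -/
def boundaryBases (W : Diagram k n) (D : Move k n) : Set (Fin k ↪o Fin n) :=
  {I | ∃ C, HasShape W C ∧ D.delta C = 0 ∧ maxMinor C I ≠ 0}

/-- The closed cell `Σ(W)`. -/
def closedCell (W : Diagram k n) : Set (Grassmannian k n) := closure (positroidCell (bases W))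

open Classical in
/-- All pairs of an admissible diagram `W` and one of its boundary diagrams `∂_{p,v}(W)` such that
the matrix `𝒞(∂_{p,v}(W))` defines the positroid with bases `B`. -/
noncomputable def contributions (B : Set (Fin k ↪o Fin n)) : Finset (Diagram k n × Move k n) :=
  Finset.univ.filter fun x =>
    Admissible x.1 ∧ x.2 ∈ boundaries x.1 ∧ boundaryBases x.1 x.2 = B

end Cells

/-! ### The integrals -/

section Integrals

variable {k n : ℕ} [NeZero n]

/-- The denominator `R_e(W)`, as a function of the entries of `𝒞(W)`. -/
def denomEdge (W : Diagram k n) (e : Fin n) (C : Matrix (Fin k) (Fin n) ℝ) : ℝ :=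
  (∏ a with IsFirst W e a, C a (e + 1)) * (∏ a with IsLast W e a, C a e) *
    ∏ x : Fin k × Fin k with Consecutive W e x.1 x.2,
      (C x.1 e * C x.2 (e + 1) - C x.2 e * C x.1 (e + 1))

/-- The denominator `R(W)`, a product over the edges that carry a propagator. -/
def denom (W : Diagram k n) (C : Matrix (Fin k) (Fin n) ℝ) : ℝ :=
  ∏ e with ∃ b, Incident W e b, denomEdge W e C

/-- The four vertices `i, i + 1, j, j + 1` of a propagator `(i, j)`. -/
def vertexList (p : Propagator n) : Fin 4 → Fin n := ![p.1, p.1 + 1, p.2, p.2 + 1]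

/-- The determinant `⟨i (i+1) j (j+1)⟩` of twistor components, for `p = (i, j)`. -/
noncomputable def bracket (Z : Fin n → Fin 4 → ℝ) (p : Propagator n) : ℝ :=
  (Matrix.of fun s => Z (vertexList p s)).det

/-- The determinant `⟨i (i+1) j (j+1)⟩` with `Z_a` replaced by the gauge vector `z`. -/
noncomputable def gaugeBracket (Z : Fin n → Fin 4 → ℝ) (z : Fin 4 → ℝ) (p : Propagator n)
    (a : Fin n) : ℝ :=
  (Matrix.of fun s => if vertexList p s = a then z else Z (vertexList p s)).det

/-- The matrix `𝒞(W)` evaluated at the solution of `𝒞_*(W) · 𝒵_*^μ = 0`, that is, of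
`z + ∑ a, c_{b,a} Z_a = 0` for every `b`, as given by Cramer's rule. -/
noncomputable def localized (W : Diagram k n) (Z : Fin n → Fin 4 → ℝ) (z : Fin 4 → ℝ) :
    Matrix (Fin k) (Fin n) ℝ :=
  Matrix.of fun b a =>
    if a ∈ support (W b) then -(gaugeBracket Z z (W b) a / bracket Z (W b)) else 0

variable {V : Type*} [AddCommGroup V] [Module ℝ V]

/-- The bosonized fermionic component `Z_i^{4+b} = ∑_A φ_b^A η_i^A`: the `η_i^A` are the four
anticommuting components of the external particle `i` and the `φ_b^A` are auxiliary anticommuting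
variables, one set of four for each row of `𝒞_*(W)`. -/
noncomputable def bosonized (φ : Fin k → Fin 4 → V) (η : Fin n → Fin 4 → V) (b : Fin k)
    (i : Fin n) : ExteriorAlgebra ℝ V :=
  ∑ A, ExteriorAlgebra.ι ℝ (φ b A) * ExteriorAlgebra.ι ℝ (η i A)

/-- The component `Y_b^{4+b}` of the row vector `Y_b = 𝒞_*(W)_b · 𝒵_*`; the gauge vector has fermionic
components zero. -/
noncomputable def fermionicRow (φ : Fin k → Fin 4 → V) (η : Fin n → Fin 4 → V)
    (C : Matrix (Fin k) (Fin n) ℝ) (b : Fin k) : ExteriorAlgebra ℝ V :=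
  ∑ a, C b a • bosonized φ η b a

/-- The function `∏_b (Y_b^{4+b})^4 / R(W)` of the entries of `𝒞(W)`, which is integrated against
`∏_b δ^4(Y_b^μ)`. -/
noncomputable def integrand (W : Diagram k n) (φ : Fin k → Fin 4 → V) (η : Fin n → Fin 4 → V)
    (C : Matrix (Fin k) (Fin n) ℝ) : ExteriorAlgebra ℝ V :=
  (denom W C)⁻¹ • (List.ofFn fun b => fermionicRow φ η C b ^ 4).prod

/-- The integral `ℐ(W)(𝒵_*)`. The factor `δ^4(Y_b^μ)`, where
`Y_b^μ = z + ∑ a ∈ V_{p_b}, c_{b,a} Z_a`, is integrated over the four variables `c_{b,a}` by the rule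
`∫ f(c) δ^4(z + c M) d^4c = f(- z M⁻¹) / det M`, where `M` has the rows `Z_i, Z_{i+1}, Z_j, Z_{j+1}`,
so that `det M = ⟨i (i+1) j (j+1)⟩`. -/
noncomputable def integral (W : Diagram k n) (φ : Fin k → Fin 4 → V) (η : Fin n → Fin 4 → V)
    (Z : Fin n → Fin 4 → ℝ) (z : Fin 4 → ℝ) : ExteriorAlgebra ℝ V :=
  (∏ b, bracket Z (W b))⁻¹ • integrand W φ η (localized W Z z)

/-- `r` is the residue at `t = 0` of a function with at most a simple pole there and with values in
the Grassmann algebra, measured through all linear functionals (all components). -/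
def HasSimpleResidue (f : ℝ → ExteriorAlgebra ℝ V) (r : ExteriorAlgebra ℝ V) : Prop :=
  ∀ l : Module.Dual ℝ (ExteriorAlgebra ℝ V),
    Tendsto (fun t => t * l (f t)) (𝓝[≠] 0) (𝓝 (l r))

/-- The twistor components of the external particles are in general position. -/
def GeneralPosition (Z : Fin n → Fin 4 → ℝ) : Prop :=
  ∀ s : Fin 4 → Fin n, Function.Injective s → (Matrix.of fun i => Z (s i)).det ≠ 0

/-- The line `t ↦ z + t u` of gauge vectors is transversal at `t = 0` to the polar locus
`Δ_{p,v}(W) = 0` given by the boundary diagram `D` of `W`, away from all other polar loci: no factor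
of `R(W)` other than `Δ_{p,v}(W)` vanishes at `z`, and if `Δ_{p,v}(W)` vanishes at `z`, then it does
so to first order along the line. -/
def Transversal (W : Diagram k n) (D : Move k n) (Z : Fin n → Fin 4 → ℝ) (z u : Fin 4 → ℝ) : Prop :=
  (∀ D' ∈ boundaries W, D' ≠ D → D'.delta (localized W Z z) ≠ 0) ∧
  (D.delta (localized W Z z) = 0 →
    deriv (fun t : ℝ => D.delta (localized W Z (z + t • u))) 0 ≠ 0)

end Integrals

end WilsonLoop

namespace WilsonLoop

/-! ### Commuting elements of the exterior algebra -/

/-! For a propagator `p`, the row of `localized` is the unique vector `c` supported on `support p`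
with `∑ a, c a • Z a = -z` (`sum_row`, `eq_row`). Uniqueness makes it linear in `z`, so along a line
of gauge vectors every entry is affine in `t` and every Δ is a polynomial in `t`. Since `denom` is
the product of the Δ over `boundaries` (`denom_eq_prod_boundaries`), transversality leaves at most
one vanishing factor, and the residue is explicit: numerator over brackets, remaining factors and
derivative of Δ (`residue`, `hasSimpleResidue_integral`).

The pairs (diagram, boundary) are partitioned into small sets, on each of which the boundary
positroid is constant; the residues already cancel inside each set, so the sum over a given `B`
vanishes. Up to the dihedral group there are eight kinds of sets, of four types. Single boundaries:
the vanishing of Δ would make the two rows equal, hence also a touching minor zero, which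
transversality excludes; the residue is 0 (`residue_eq_zero_of_touch`). Pairs: two propagators that
lose different vertices keep the same three vertices. Their rows coincide on the polar locus, and
the scaled derivatives of their Δ are opposite (`Slides`). Triples: three propagators, or three up
to a slide, have rows that all represent `-z`. The polar conditions agree away from the excluded
loci, and there one row is an affine combination of the other two. The numerator of a pair of rows
scales by the fourth power of the determinant of a change of rows (`numer_comb`), so the sum of the
residues reduces to a rational identity in the single parameter of that combination
(`residue_touch_triple`, `residue_slide_touch_triple`). The finite bookkeeping (list of diagrams,
partition, constancy of the positroid, compatibility with the symmetry) is done by kernel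
evaluation. -/

theorem add_pow_four_of_commute {R : Type*} [Ring R] {a b c d : R} (hab : Commute a b)
    (hac : Commute a c) (had : Commute a d) (hbc : Commute b c) (hbd : Commute b d)
    (hcd : Commute c d) (ha : a * a = 0) (hb : b * b = 0) (hc : c * c = 0) (hd : d * d = 0) :
    (a + b + c + d) ^ 4 = 24 * (a * b * c * d) := by
  -- The sums `a + b` and `c + d` each have cube zero, so only the middle binomial term survives,
  -- with coefficient 6 · 2 · 2 = 24.
  have key : ∀ {x y : R}, Commute x y → x * x = 0 → y * y = 0 →
      (x + y) ^ 2 = 2 * (x * y) ∧ (x + y) ^ 3 = 0 := by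
    intro x y h hx hy
    have h2 : (x + y) ^ 2 = 2 * (x * y) := by
      rw [h.add_sq, pow_two, pow_two, hx, hy, zero_add, add_zero, mul_assoc]
    refine ⟨h2, ?_⟩
    have h1 : x * y * x = 0 := by rw [h.eq, mul_assoc, hx, mul_zero]
    have h3 : x * y * y = 0 := by rw [mul_assoc, hy, mul_zero]
    rw [pow_succ, h2, mul_add, mul_assoc 2, mul_assoc 2, h1, h3, mul_zero, add_zero]
  have hXY : Commute (a + b) (c + d) :=
    (hac.add_right had).add_left (hbc.add_right hbd)
  obtain ⟨hX2, hX3⟩ := key hab ha hb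
  obtain ⟨hY2, hY3⟩ := key hcd hc hd
  have hX4 : (a + b) ^ 4 = 0 := by rw [pow_succ, hX3, zero_mul]
  have hY4 : (c + d) ^ 4 = 0 := by rw [pow_succ, hY3, zero_mul]
  rw [add_assoc, hXY.add_pow]
  simp only [Finset.sum_range_succ, Finset.sum_range_zero, pow_zero, pow_one, hX2, hX3, hX4, hY2,
    hY3, hY4, mul_zero, zero_mul, add_zero, zero_add, Nat.reduceSub, Nat.reduceAdd]
  rw [show Nat.choose 4 2 = 6 by decide]
  have e2 : ∀ x y : R, 2 * x * (2 * y) * ((6 : ℕ) : R) = 24 * (x * y) := by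
    intro x y
    have : ((6 : ℕ) : R) = 6 := by norm_num
    rw [this, two_mul, two_mul]
    have h6 : ∀ w : R, w * 6 = w + w + w + w + w + w := by
      intro w; rw [show (6 : R) = 1 + 1 + 1 + 1 + 1 + 1 by norm_num]; simp only [mul_add, mul_one]
    have h24 : ∀ w : R, 24 * w = 4 • (w + w + w + w + w + w) := by
      intro w
      rw [show w + w + w + w + w + w = 6 • w by abel, smul_smul, nsmul_eq_mul]; norm_num
    rw [h6, h24]
    simp only [add_mul, mul_add]; abel
  rw [e2, mul_assoc (a * b)]

/-! ### The fermionic numerator and its behaviour under row operations -/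

section Exterior

variable {V : Type*} [AddCommGroup V] [Module ℝ V]

local notation "ε" => ExteriorAlgebra.ι ℝ

theorem ι_mul_ι_swap (x y : V) : ε x * ε y = -(ε y * ε x) :=
  eq_neg_of_add_eq_zero_left (ExteriorAlgebra.ι_add_mul_swap x y)

theorem commute_ι_ι (p x q y : V) : Commute (ε p * ε x) (ε q * ε y) := by
  have h : ∀ a : V, Commute (ε p * ε x) (ε a) := by
    intro a
    change ε p * ε x * ε a = ε a * (ε p * ε x)
    rw [mul_assoc, ι_mul_ι_swap x a, mul_neg, ← mul_assoc, ι_mul_ι_swap p a]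
    simp [mul_assoc]
  exact (h q).mul_right (h y)

theorem ι_ι_sq (p x : V) : (ε p * ε x) * (ε p * ε x) = 0 := by
  rw [mul_assoc, ← mul_assoc (ε x), ι_mul_ι_swap x p]
  simp only [neg_mul, mul_neg, ← mul_assoc, ExteriorAlgebra.ι_sq_zero, zero_mul, neg_zero]

/-- After the auxiliary vectors are pulled to the front, the product of two one-forms transforms
under a 2 × 2 change of basis by its determinant. This is the contribution of one value of the index
`A`. -/
theorem ι_pair_comb (p q x y : V) (a b c d : ℝ) :
    (ε p * ε (a • x + b • y)) * (ε q * ε (c • x + d • y)) =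
      (a * d - b * c) • ((ε p * ε x) * (ε q * ε y)) := by
  have h : ∀ v w : V, (ε p * ε v) * (ε q * ε w) = -((ε p * ε q) * (ε v * ε w)) := by
    intro v w
    rw [mul_assoc, ← mul_assoc (ε v), ι_mul_ι_swap v q]
    simp [mul_assoc]
  rw [h, h]
  have : ε (a • x + b • y) * ε (c • x + d • y) = (a * d - b * c) • (ε x * ε y) := by
    simp only [map_add, map_smul, add_mul, mul_add, smul_mul_assoc, mul_smul_comm,
      ExteriorAlgebra.ι_sq_zero, smul_zero, zero_add, add_zero, ι_mul_ι_swap y x, smul_neg,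
      smul_smul, sub_smul]
    rw [mul_comm d a, mul_comm c b]
    abel
  rw [this, mul_smul_comm, smul_neg]

/-- The component `∑_A φ^A θ^A(x)` of a row vector `x`. -/
noncomputable def rowForm {n : ℕ} (f : Fin 4 → V) (η : Fin n → Fin 4 → V) (x : Fin n → ℝ) :
    ExteriorAlgebra ℝ V :=
  ∑ A, ε (f A) * ε (∑ a, x a • η a A)

theorem fermionicRow_eq {k n : ℕ} (φ : Fin k → Fin 4 → V) (η : Fin n → Fin 4 → V)
    (C : Matrix (Fin k) (Fin n) ℝ) (b : Fin k) :
    fermionicRow φ η C b = rowForm (φ b) η (C b) := by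
  unfold fermionicRow rowForm bosonized
  simp only [map_sum, map_smul, Finset.mul_sum, Finset.smul_sum, mul_smul_comm]
  rw [Finset.sum_comm]

/-- The product of the fourth powers of the fermionic components of two row vectors. -/
noncomputable def numer {n : ℕ} (φ : Fin 2 → Fin 4 → V) (η : Fin n → Fin 4 → V)
    (x y : Fin n → ℝ) : ExteriorAlgebra ℝ V :=
  rowForm (φ 0) η x ^ 4 * rowForm (φ 1) η y ^ 4

theorem numer_eq {n : ℕ} (φ : Fin 2 → Fin 4 → V) (η : Fin n → Fin 4 → V)
    (C : Matrix (Fin 2) (Fin n) ℝ) :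
    (List.ofFn fun b => fermionicRow φ η C b ^ 4).prod = numer φ η (C 0) (C 1) := by
  simp [numer, fermionicRow_eq, List.ofFn_succ]

theorem rowForm_pow_four {n : ℕ} (f : Fin 4 → V) (η : Fin n → Fin 4 → V) (x : Fin n → ℝ) :
    rowForm f η x ^ 4 = 24 * ((ε (f 0) * ε (∑ a, x a • η a 0)) *
      (ε (f 1) * ε (∑ a, x a • η a 1)) * (ε (f 2) * ε (∑ a, x a • η a 2)) *
      (ε (f 3) * ε (∑ a, x a • η a 3))) := by
  unfold rowForm
  rw [Fin.sum_univ_four]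
  exact add_pow_four_of_commute (commute_ι_ι ..) (commute_ι_ι ..) (commute_ι_ι ..)
    (commute_ι_ι ..) (commute_ι_ι ..) (commute_ι_ι ..) (ι_ι_sq ..) (ι_ι_sq ..) (ι_ι_sq ..)
    (ι_ι_sq ..)

/-- Pairs of odd elements commute, so the eight factors can be regrouped by the index `A`, one
factor from each row; `ι_pair_comb` then applies to each group. -/
theorem numer_eq_prod {n : ℕ} (φ : Fin 2 → Fin 4 → V) (η : Fin n → Fin 4 → V)
    (x y : Fin n → ℝ) :
    numer φ η x y = (24 * 24) * (
      ((ε (φ 0 0) * ε (∑ a, x a • η a 0)) * (ε (φ 1 0) * ε (∑ a, y a • η a 0))) *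
      ((ε (φ 0 1) * ε (∑ a, x a • η a 1)) * (ε (φ 1 1) * ε (∑ a, y a • η a 1))) *
      ((ε (φ 0 2) * ε (∑ a, x a • η a 2)) * (ε (φ 1 2) * ε (∑ a, y a • η a 2))) *
      ((ε (φ 0 3) * ε (∑ a, x a • η a 3)) * (ε (φ 1 3) * ε (∑ a, y a • η a 3)))) := by
  unfold numer
  rw [rowForm_pow_four, rowForm_pow_four]
  have h24 : ∀ w : ExteriorAlgebra ℝ V, Commute w 24 := fun w => Commute.ofNat_right w 24
  have hc : ∀ p x q y : V, Commute (ε p * ε x) (ε q * ε y) := commute_ι_ι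
  rw [(h24 _).mul_mul_mul_comm,
    (((hc _ _ _ _).mul_right (hc _ _ _ _)).mul_right (hc _ _ _ _)).mul_mul_mul_comm,
    ((hc _ _ _ _).mul_right (hc _ _ _ _)).mul_mul_mul_comm, (hc _ _ _ _).mul_mul_mul_comm]

/-- Each of the four values of `A` contributes one determinant. Every comparison of numerators of
different diagrams rests on this covariance. -/
theorem numer_comb {n : ℕ} (φ : Fin 2 → Fin 4 → V) (η : Fin n → Fin 4 → V)
    (x y : Fin n → ℝ) (a b c d : ℝ) :
    numer φ η (a • x + b • y) (c • x + d • y) = (a * d - b * c) ^ 4 • numer φ η x y := by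
  have h : ∀ (s t : ℝ) (A : Fin 4), ∑ i, (s • x + t • y) i • η i A =
      s • (∑ i, x i • η i A) + t • ∑ i, y i • η i A := by
    intro s t A
    simp only [Pi.add_apply, Pi.smul_apply, smul_eq_mul, add_smul, Finset.sum_add_distrib,
      Finset.smul_sum, smul_smul]
  rw [numer_eq_prod, numer_eq_prod]
  simp only [h, ι_pair_comb, smul_mul_assoc, mul_smul_comm, smul_smul]
  congr 1
  ring

end Exterior

/-! ### Rows of the localized matrix -/

section Rows

variable {n : ℕ} [NeZero n]

/-- The row of `localized W Z z` that belongs to the propagator `p`. -/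
noncomputable def row (Z : Fin n → Fin 4 → ℝ) (z : Fin 4 → ℝ) (p : Propagator n) : Fin n → ℝ :=
  fun a => if a ∈ support p then -(gaugeBracket Z z p a / bracket Z p) else 0

theorem localized_apply {k : ℕ} (W : Diagram k n) (Z : Fin n → Fin 4 → ℝ) (z : Fin 4 → ℝ)
    (b : Fin k) : localized W Z z b = row Z z (W b) := rfl

theorem support_eq_image (p : Propagator n) : support p = Finset.univ.image (vertexList p) := by
  ext a
  simp [support, vertexList, Fin.exists_fin_succ, eq_comm]

theorem row_of_notMem {Z : Fin n → Fin 4 → ℝ} {z : Fin 4 → ℝ} {p : Propagator n} {a : Fin n}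
    (h : a ∉ support p) : row Z z p a = 0 := if_neg h

theorem bracket_ne_zero {Z : Fin n → Fin 4 → ℝ} (hZ : GeneralPosition Z) {p : Propagator n}
    (hp : Function.Injective (vertexList p)) : bracket Z p ≠ 0 := hZ _ hp

theorem bracket_mul_row (Z : Fin n → Fin 4 → ℝ) (hZ : GeneralPosition Z) (z : Fin 4 → ℝ)
    {p : Propagator n} (hp : Function.Injective (vertexList p)) {a : Fin n} (ha : a ∈ support p) :
    bracket Z p * row Z z p a = -gaugeBracket Z z p a := by
  have := bracket_ne_zero hZ hp
  rw [row, if_pos ha]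
  field_simp

theorem gaugeBracket_vertexList (Z : Fin n → Fin 4 → ℝ) (z : Fin 4 → ℝ) {p : Propagator n}
    (hp : Function.Injective (vertexList p)) (s : Fin 4) :
    gaugeBracket Z z p (vertexList p s) =
      ((Matrix.of fun i => Z (vertexList p i)).updateRow s z).det := by
  unfold gaugeBracket
  congr 1
  ext i j
  by_cases h : i = s
  · simp [h]
  · simp [h, hp.ne h]

/-- Cramer's rule for the matrix whose columns are the four vertices of the propagator, after
multiplication by its nonzero determinant. -/
theorem sum_row (Z : Fin n → Fin 4 → ℝ) (hZ : GeneralPosition Z) (z : Fin 4 → ℝ)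
    {p : Propagator n} (hp : Function.Injective (vertexList p)) :
    ∑ a, row Z z p a • Z a = -z := by
  have h1 : ∑ a, row Z z p a • Z a = ∑ s, row Z z p (vertexList p s) • Z (vertexList p s) := by
    rw [← Finset.sum_subset (Finset.subset_univ (support p)), support_eq_image,
      Finset.sum_image fun _ _ _ _ h => hp h]
    intro a _ ha
    rw [row_of_notMem ha, zero_smul]
  have hb := bracket_ne_zero hZ hp
  have hmem : ∀ s, vertexList p s ∈ support p := fun s => by
    rw [support_eq_image]; exact Finset.mem_image_of_mem _ (Finset.mem_univ s)
  set M : Matrix (Fin 4) (Fin 4) ℝ := Matrix.of fun i => Z (vertexList p i) with hM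
  have h2 := Matrix.mulVec_cramer M.transpose z
  rw [Matrix.det_transpose] at h2
  have h3 : bracket Z p • ∑ a, row Z z p a • Z a = bracket Z p • (-z) := by
    rw [h1, smul_neg]
    change _ = -(M.det • z)
    rw [← h2]
    ext j
    simp only [Finset.sum_apply, Finset.mul_sum, Pi.smul_apply, Pi.neg_apply,
      smul_eq_mul, Matrix.mulVec, dotProduct, Matrix.transpose_apply, ← Finset.sum_neg_distrib]
    refine Finset.sum_congr rfl fun s _ => ?_
    rw [← mul_assoc, bracket_mul_row Z hZ z hp (hmem s), gaugeBracket_vertexList Z z hp, ← hM,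
      Matrix.cramer_transpose_apply]
    simp only [hM, Matrix.of_apply]
    ring
  exact smul_right_injective _ hb h3

/-- A relation between the four vectors of a propagator is trivial. -/
theorem eq_zero_of_sum_eq_zero {Z : Fin n → Fin 4 → ℝ} (hZ : GeneralPosition Z)
    {p : Propagator n} (hp : Function.Injective (vertexList p)) {x : Fin n → ℝ}
    (hx : ∀ a ∉ support p, x a = 0) (h : ∑ a, x a • Z a = 0) : x = 0 := by
  have hb := bracket_ne_zero hZ hp
  have hli := Matrix.linearIndependent_rows_of_det_ne_zero hb
  have h1 : ∑ a, x a • Z a = ∑ s, x (vertexList p s) • Z (vertexList p s) := by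
    rw [← Finset.sum_subset (Finset.subset_univ (support p)), support_eq_image,
      Finset.sum_image fun _ _ _ _ h => hp h]
    intro a _ ha
    rw [hx a ha, zero_smul]
  rw [h1] at h
  have h2 := Fintype.linearIndependent_iff.1 hli (fun s => x (vertexList p s)) h
  ext a
  by_cases ha : a ∈ support p
  · rw [support_eq_image] at ha
    obtain ⟨s, -, rfl⟩ := Finset.mem_image.1 ha
    exact h2 s
  · exact hx a ha

/-- Uniqueness of the Cramer solution. It is used to identify rows of different propagators on a
polar locus, where a vanishing entry shrinks the support. -/
theorem eq_row {Z : Fin n → Fin 4 → ℝ} (hZ : GeneralPosition Z) {z : Fin 4 → ℝ}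
    {p : Propagator n} (hp : Function.Injective (vertexList p)) {x : Fin n → ℝ}
    (hx : ∀ a ∉ support p, x a = 0) (h : ∑ a, x a • Z a = -z) : x = row Z z p := by
  refine sub_eq_zero.1 (eq_zero_of_sum_eq_zero hZ hp (x := x - row Z z p) ?_ ?_)
  · intro a ha
    simp [hx a ha, row_of_notMem ha]
  · simp [sub_smul, Finset.sum_sub_distrib, h, sum_row Z hZ z hp]

theorem row_add_smul {Z : Fin n → Fin 4 → ℝ} (hZ : GeneralPosition Z) (z u : Fin 4 → ℝ) (t : ℝ)
    {p : Propagator n} (hp : Function.Injective (vertexList p)) :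
    row Z (z + t • u) p = row Z z p + t • row Z u p := by
  symm
  apply eq_row hZ hp
  · intro a ha
    simp [row_of_notMem ha]
  · simp only [Pi.add_apply, Pi.smul_apply, smul_eq_mul, add_smul, Finset.sum_add_distrib,
      mul_smul, ← Finset.smul_sum, sum_row Z hZ _ hp]
    module

theorem localized_add_smul {k : ℕ} {W : Diagram k n} {Z : Fin n → Fin 4 → ℝ}
    (hZ : GeneralPosition Z) (z u : Fin 4 → ℝ) (t : ℝ)
    (hp : ∀ b, Function.Injective (vertexList (W b))) :
    localized W Z (z + t • u) = localized W Z z + t • localized W Z u := by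
  ext b a
  exact congrFun (row_add_smul hZ z u t (hp b)) a

end Rows

/-! ### Residues -/

section Residues

/-- The product of all `Δ_{p,v}(W)` other than the one given by `x.2`. -/
def cofactor (x : Diagram 2 6 × Move 2 6) (C : Matrix (Fin 2) (Fin 6) ℝ) : ℝ :=
  ∏ D ∈ (boundaries x.1).erase x.2, D.delta C

/-- The derivative of `D.delta` at `C` in the direction `C'`. -/
def Move.deltaDeriv {k n : ℕ} [NeZero n] (D : Move k n) (C C' : Matrix (Fin k) (Fin n) ℝ) : ℝ :=
  match D with
  | .leave b v => C' b v
  | .touch e a b => C' a e * C b (e + 1) + C a e * C' b (e + 1) -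
      (C' b e * C a (e + 1) + C b e * C' a (e + 1))

theorem Move.hasDerivAt_delta {k n : ℕ} [NeZero n] (D : Move k n)
    (C C' : Matrix (Fin k) (Fin n) ℝ) :
    HasDerivAt (fun t : ℝ => D.delta (C + t • C')) (D.deltaDeriv C C') 0 := by
  have h : ∀ b v, HasDerivAt (fun t : ℝ => (C + t • C') b v) (C' b v) 0 := by
    intro b v
    simpa using ((hasDerivAt_id (0 : ℝ)).mul_const (C' b v)).const_add (C b v)
  cases D with
  | leave b v => exact h b v
  | touch e a b =>
    have := ((h a e).mul (h b (e + 1))).sub ((h b e).mul (h a (e + 1)))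
    exact this.congr_deriv (by simp [Move.deltaDeriv])

theorem Move.continuous_delta {k n : ℕ} [NeZero n] (D : Move k n) :
    Continuous fun C : Matrix (Fin k) (Fin n) ℝ => D.delta C := by
  cases D with
  | leave b v => exact continuous_id.matrix_elem b v
  | touch e a b =>
    exact ((continuous_id.matrix_elem a e).mul (continuous_id.matrix_elem b (e + 1))).sub
      ((continuous_id.matrix_elem b e).mul (continuous_id.matrix_elem a (e + 1)))

variable {V : Type*} [AddCommGroup V] [Module ℝ V]

/-- Functions with values in a real algebra that are finite sums of products of continuous
real-valued functions and constants. -/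
def IsFiniteRank {A : Type*} [Ring A] [Algebra ℝ A] (f : ℝ → A) : Prop :=
  ∃ (m : ℕ) (g : Fin m → ℝ → ℝ) (w : Fin m → A), (∀ i, Continuous (g i)) ∧
    ∀ t, f t = ∑ i, g i t • w i

namespace IsFiniteRank

variable {A : Type*} [Ring A] [Algebra ℝ A]

theorem of_fintype {ι : Type*} [Fintype ι] {f : ℝ → A} (g : ι → ℝ → ℝ) (w : ι → A)
    (hg : ∀ i, Continuous (g i)) (hf : ∀ t, f t = ∑ i, g i t • w i) : IsFiniteRank f := by
  let e := Fintype.equivFin ι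
  refine ⟨_, fun i => g (e.symm i), fun i => w (e.symm i), fun i => hg _, fun t => ?_⟩
  rw [hf, ← Equiv.sum_comp e.symm]

theorem mul {f g : ℝ → A} (hf : IsFiniteRank f) (hg : IsFiniteRank g) :
    IsFiniteRank fun t => f t * g t := by
  obtain ⟨m, a, v, ha, hf⟩ := hf
  obtain ⟨l, b, w, hb, hg⟩ := hg
  refine of_fintype (ι := Fin m × Fin l) (fun i t => a i.1 t * b i.2 t) (fun i => v i.1 * w i.2)
    (fun i => (ha _).mul (hb _)) fun t => ?_
  rw [hf, hg, Finset.sum_mul_sum, Fintype.sum_prod_type]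
  simp only [smul_mul_smul_comm]

theorem pow {f : ℝ → A} (hf : IsFiniteRank f) (k : ℕ) : IsFiniteRank fun t => f t ^ (k + 1) := by
  induction k with
  | zero => simpa using hf
  | succ k ih => simpa only [pow_succ _ (k + 1)] using ih.mul hf

theorem continuous_dual {f : ℝ → A} (hf : IsFiniteRank f) (l : Module.Dual ℝ A) :
    Continuous fun t => l (f t) := by
  obtain ⟨m, a, v, ha, hf⟩ := hf
  simp only [hf, map_sum, map_smul, smul_eq_mul]
  exact continuous_finsetSum _ fun i _ => (ha i).mul continuous_const

end IsFiniteRank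

/-- No topology on the exterior algebra is needed: the numerator is a finite sum of continuous
scalars times constants, and a linear functional acts on the constants. -/
theorem continuous_dual_numer (φ : Fin 2 → Fin 4 → V) (η : Fin 6 → Fin 4 → V)
    (C C' : Matrix (Fin 2) (Fin 6) ℝ) (l : Module.Dual ℝ (ExteriorAlgebra ℝ V)) :
    Continuous fun t : ℝ => l (numer φ η ((C + t • C') 0) ((C + t • C') 1)) := by
  have h : ∀ b, IsFiniteRank fun t : ℝ => rowForm (φ b) η ((C + t • C') b) := by
    intro b
    refine IsFiniteRank.of_fintype (fun a t => (C + t • C') b a) (fun a => bosonized φ η b a)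
      (fun a => ?_) fun t => ?_
    · simp only [Matrix.add_apply, Matrix.smul_apply]
      fun_prop
    · rw [← fermionicRow_eq]; rfl
  -- `IsFiniteRank.pow` raises to the exponent plus one, so 3 stands for the fourth power.
  exact (((h 0).pow 3).mul ((h 1).pow 3)).continuous_dual l

open Classical in
/-- The residue at `t = 0` of the integral of the diagram `x.1` along `z + t u`, when the only
factor of its denominator that may vanish at `z` is the one given by `x.2`. -/
noncomputable def residue (φ : Fin 2 → Fin 4 → V) (η : Fin 6 → Fin 4 → V)
    (Z : Fin 6 → Fin 4 → ℝ) (z u : Fin 4 → ℝ) (x : Diagram 2 6 × Move 2 6) :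
    ExteriorAlgebra ℝ V :=
  if x.2.delta (localized x.1 Z z) = 0 then
    ((∏ b, bracket Z (x.1 b)) * cofactor x (localized x.1 Z z) *
      x.2.deltaDeriv (localized x.1 Z z) (localized x.1 Z u))⁻¹ •
      numer φ η (localized x.1 Z z 0) (localized x.1 Z z 1)
  else 0

theorem hasSimpleResidue_integral (φ : Fin 2 → Fin 4 → V) (η : Fin 6 → Fin 4 → V)
    {Z : Fin 6 → Fin 4 → ℝ} (hZ : GeneralPosition Z) {z u : Fin 4 → ℝ}
    {x : Diagram 2 6 × Move 2 6} (hp : ∀ b, Function.Injective (vertexList (x.1 b)))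
    (hx : x.2 ∈ boundaries x.1)
    (hden : ∀ C, denom x.1 C = ∏ D ∈ boundaries x.1, D.delta C)
    (htr : Transversal x.1 x.2 Z z u) :
    HasSimpleResidue (fun t => integral x.1 φ η Z (z + t • u)) (residue φ η Z z u x) := by
  obtain ⟨W, D⟩ := x
  simp only at hp hx hden htr
  intro l
  set C := localized W Z z with hC
  set C' := localized W Z u with hC'
  have hloc : ∀ t : ℝ, localized W Z (z + t • u) = C + t • C' :=
    fun t => localized_add_smul hZ z u t hp
  have hcof : Continuous fun t : ℝ => cofactor (W, D) (C + t • C') := by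
    unfold cofactor
    refine continuous_finsetProd _ fun D' _ => D'.continuous_delta.comp ?_
    fun_prop
  have hcof0 : cofactor (W, D) (C + (0 : ℝ) • C') ≠ 0 := by
    rw [zero_smul, add_zero]
    refine Finset.prod_ne_zero_iff.2 fun D' hD' => ?_
    exact htr.1 D' (Finset.mem_of_mem_erase hD') (Finset.ne_of_mem_erase hD')
  have hder := D.hasDerivAt_delta C C'
  have hd0 : D.delta C = D.delta (C + (0 : ℝ) • C') := by rw [zero_smul, add_zero]
  -- Isolates the only factor that may be singular, `t / Δ(t)`; the rest converges. The quotient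
  -- tends to the inverse derivative if Δ vanishes at 0, and to 0 otherwise.
  have hfun : ∀ t : ℝ, t * l (integral W φ η Z (z + t • u)) =
      (∏ b, bracket Z (W b))⁻¹ * (t / D.delta (C + t • C')) *
        (cofactor (W, D) (C + t • C'))⁻¹ * l (numer φ η ((C + t • C') 0) ((C + t • C') 1)) := by
    intro t
    unfold integral integrand
    rw [hloc, numer_eq, hden, ← Finset.mul_prod_erase _ _ hx, mul_inv]
    simp only [map_smul, smul_eq_mul, cofactor]
    ring
  simp only [hfun]
  have hlim : Tendsto (fun t : ℝ => (cofactor (W, D) (C + t • C'))⁻¹ *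
      l (numer φ η ((C + t • C') 0) ((C + t • C') 1))) (𝓝[≠] 0)
      (𝓝 ((cofactor (W, D) C)⁻¹ * l (numer φ η (C 0) (C 1)))) := by
    have := (hcof.continuousAt.inv₀ hcof0).mul (continuous_dual_numer φ η C C' l).continuousAt
    have h2 := this.tendsto
    simp only [zero_smul, add_zero, Pi.mul_apply, Pi.inv_apply] at h2
    exact h2.mono_left nhdsWithin_le_nhds
  unfold residue
  split_ifs with h0
  · change D.delta C = 0 at h0
    have hne : D.deltaDeriv C C' ≠ 0 := by
      have := htr.2 h0
      simp only [hloc] at this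
      rwa [hder.deriv] at this
    have hslope : Tendsto (fun t : ℝ => t / D.delta (C + t • C')) (𝓝[≠] 0)
        (𝓝 (D.deltaDeriv C C')⁻¹) := by
      have := (hasDerivAt_iff_tendsto_slope_zero.1 hder).inv₀ hne
      simpa [← hd0, h0, div_eq_mul_inv, mul_comm] using this
    have := (hslope.const_mul (∏ b, bracket Z (W b))⁻¹).mul hlim
    convert this using 2
    · ring
    · simp only [map_smul, smul_eq_mul, mul_inv]
      ring
  · change ¬ D.delta C = 0 at h0
    have hq : Tendsto (fun t : ℝ => t / D.delta (C + t • C')) (𝓝[≠] 0) (𝓝 0) := by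
      have h1 := (continuousAt_id (x := (0 : ℝ))).div hder.continuousAt (by rwa [← hd0])
      have h2 := h1.tendsto
      simp only [Pi.div_apply, id, zero_div] at h2
      exact h2.mono_left nhdsWithin_le_nhds
    have := (hq.const_mul (∏ b, bracket Z (W b))⁻¹).mul hlim
    convert this using 2
    · ring
    · simp

end Residues

/-! ### The denominator as a product over boundary diagrams -/

section Denominator

variable {k n : ℕ} [NeZero n]

/-- The boundary diagrams in which an end on the edge `e` has moved. -/
def edgeMoves (W : Diagram k n) (e : Fin n) : Finset (Move k n) :=
  ((Finset.univ.filter fun a => IsFirst W e a).image fun a => Move.leave a (e + 1)) ∪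
    ((Finset.univ.filter fun a => IsLast W e a).image fun a => Move.leave a e) ∪
    (Finset.univ.filter fun x : Fin k × Fin k => Consecutive W e x.1 x.2).image
      fun x => Move.touch e x.1 x.2

theorem boundaries_eq_biUnion (W : Diagram k n) :
    boundaries W = Finset.univ.biUnion (edgeMoves W) := by
  ext D
  simp only [boundaries, edgeMoves, Finset.mem_filter, Finset.mem_univ, true_and,
    Finset.mem_biUnion, Finset.mem_union, Finset.mem_image, Prod.exists]
  constructor
  · rintro ⟨b, v, -, e, -, h⟩
    refine ⟨e, ?_⟩
    rcases h with ⟨rfl, ⟨a, h, rfl⟩ | ⟨h, rfl⟩⟩ | ⟨rfl, ⟨a, h, rfl⟩ | ⟨h, rfl⟩⟩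
    · exact Or.inr ⟨b, a, h, rfl⟩
    · exact Or.inl (Or.inr ⟨b, h, rfl⟩)
    · exact Or.inr ⟨a, b, h, rfl⟩
    · exact Or.inl (Or.inl ⟨b, h, rfl⟩)
  · have hs : ∀ {e : Fin n} {b : Fin k}, Incident W e b →
        e ∈ support (W b) ∧ e + 1 ∈ support (W b) := by
      rintro e b (rfl | rfl) <;> simp [support]
    rintro ⟨e, (⟨b, h, rfl⟩ | ⟨b, h, rfl⟩) | ⟨a, b, h, rfl⟩⟩
    · exact ⟨b, e + 1, (hs h.1).2, e, h.1, Or.inr ⟨rfl, Or.inr ⟨h, rfl⟩⟩⟩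
    · exact ⟨b, e, (hs h.1).1, e, h.1, Or.inl ⟨rfl, Or.inr ⟨h, rfl⟩⟩⟩
    · exact ⟨a, e, (hs h.1.1).1, e, h.1.1, Or.inl ⟨rfl, Or.inl ⟨b, h, rfl⟩⟩⟩


/-- A propagator with four distinct support vertices never joins adjacent edges. Hence a support
vertex belongs to only one of its ends, and the same factor `C b v` cannot arise from two edges of
the denominator. -/
theorem incident_succ_false {W : Diagram k n} (hW : ∀ b, Function.Injective (vertexList (W b)))
    {e : Fin n} {b : Fin k} (h : Incident W e b) (h' : Incident W (e + 1) b) : False := by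
  have h01 := (hW b).ne (show (0 : Fin 4) ≠ 1 by decide)
  have h12 := (hW b).ne (show (1 : Fin 4) ≠ 2 by decide)
  have h23 := (hW b).ne (show (2 : Fin 4) ≠ 3 by decide)
  have h30 := (hW b).ne (show (3 : Fin 4) ≠ 0 by decide)
  simp only [vertexList, Matrix.cons_val] at h01 h12 h23 h30
  rcases h with rfl | rfl <;> rcases h' with h' | h'
  · exact h01 h'
  · exact h12 h'.symm
  · exact h30 h'.symm
  · exact h23 h'

theorem edge_ne_succ {W : Diagram k n} (hW : ∀ b, Function.Injective (vertexList (W b)))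
    {e : Fin n} {b : Fin k} (h : Incident W e b) : e ≠ e + 1 := fun he =>
  incident_succ_false hW h (he ▸ h)

theorem disjoint_edgeMoves {W : Diagram k n} (hW : ∀ b, Function.Injective (vertexList (W b)))
    {e e' : Fin n} (he : e ≠ e') : Disjoint (edgeMoves W e) (edgeMoves W e') := by
  rw [Finset.disjoint_left]
  simp only [edgeMoves, Finset.mem_filter, Finset.mem_univ, true_and, Finset.mem_union,
    Finset.mem_image, Prod.exists]
  rintro D ((⟨b, h, rfl⟩ | ⟨b, h, rfl⟩) | ⟨a, b, h, rfl⟩)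
    ((⟨c, h', hD⟩ | ⟨c, h', hD⟩) | ⟨c, d, h', hD⟩) <;>
    simp only [Move.leave.injEq, Move.touch.injEq, reduceCtorEq] at hD
  · exact he (add_right_cancel hD.2).symm
  · obtain ⟨rfl, rfl⟩ := hD
    exact incident_succ_false hW h.1 h'.1
  · obtain ⟨rfl, rfl⟩ := hD
    exact incident_succ_false hW h'.1 h.1
  · exact he hD.2.symm
  · exact he hD.1.symm

theorem prod_edgeMoves {W : Diagram k n} (hW : ∀ b, Function.Injective (vertexList (W b)))
    (e : Fin n) (C : Matrix (Fin k) (Fin n) ℝ) :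
    ∏ D ∈ edgeMoves W e, D.delta C = denomEdge W e C := by
  unfold edgeMoves denomEdge
  rw [Finset.prod_union, Finset.prod_union, Finset.prod_image, Finset.prod_image,
    Finset.prod_image]
  · rfl
  · rintro ⟨a, b⟩ - ⟨c, d⟩ - h
    simpa using h
  · intro a _ b _ h
    simpa using h
  · intro a _ b _ h
    simpa using h
  · rw [Finset.disjoint_left]
    simp only [Finset.mem_filter, Finset.mem_univ, true_and, Finset.mem_image]
    rintro D ⟨b, h, rfl⟩ ⟨c, h', hD⟩
    simp only [Move.leave.injEq] at hD
    exact edge_ne_succ hW h.1 hD.2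
  · rw [Finset.disjoint_left]
    simp only [Finset.mem_filter, Finset.mem_univ, true_and, Finset.mem_union, Finset.mem_image,
      Prod.exists]
    rintro D (⟨b, h, rfl⟩ | ⟨b, h, rfl⟩) ⟨c, d, h', hD⟩ <;> simp at hD

/-- The factors of `R(W)` are exactly the `Δ_{p,v}(W)`, one for each boundary diagram. -/
theorem denom_eq_prod_boundaries {W : Diagram k n}
    (hW : ∀ b, Function.Injective (vertexList (W b))) (C : Matrix (Fin k) (Fin n) ℝ) :
    denom W C = ∏ D ∈ boundaries W, D.delta C := by
  rw [boundaries_eq_biUnion, Finset.prod_biUnion fun e _ e' _ h => disjoint_edgeMoves hW h]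
  simp only [prod_edgeMoves hW]
  refine Finset.prod_subset (Finset.filter_subset _ _) fun e _ he => ?_
  have hne : ∀ b, ¬ Incident W e b := by simpa using he
  unfold denomEdge
  rw [Finset.prod_eq_one, Finset.prod_eq_one, Finset.prod_eq_one]
  · simp
  · intro x hx
    exact absurd (Finset.mem_filter.1 hx).2.1.1 (hne _)
  · intro x hx
    exact absurd (Finset.mem_filter.1 hx).2.1 (hne _)
  · intro x hx
    exact absurd (Finset.mem_filter.1 hx).2.1 (hne _)

end Denominator

/-! ### The dihedral symmetry of the hexagon -/

section Dihedral

/-- The symmetry `v ↦ k + v` (`g = (k, false)`) or `v ↦ k - v` (`g = (k, true)`) of the hexagon. -/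
def actVertex (g : Fin 6 × Bool) (v : Fin 6) : Fin 6 := if g.2 then g.1 - v else g.1 + v

/-- The action on edges; the edge `e` joins `e` and `e + 1`. -/
def actEdge (g : Fin 6 × Bool) (e : Fin 6) : Fin 6 := if g.2 then g.1 - e - 1 else g.1 + e

/-- The action on propagators, which are listed with the smaller edge first. -/
def actPropagator (g : Fin 6 × Bool) (p : Propagator 6) : Propagator 6 :=
  (min (actEdge g p.1) (actEdge g p.2), max (actEdge g p.1) (actEdge g p.2))

/-- The permutation of rows that is needed to list the propagators of the image in order. -/
def rowSwap (g : Fin 6 × Bool) (W : Diagram 2 6) : Fin 2 → Fin 2 :=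
  if (actPropagator g (W 0)).1 < (actPropagator g (W 1)).1 ∨
    ((actPropagator g (W 0)).1 = (actPropagator g (W 1)).1 ∧
      (actPropagator g (W 1)).2 < (actPropagator g (W 0)).2) then id else ![1, 0]

/-- The action on diagrams. -/
def actDiagram (g : Fin 6 × Bool) (W : Diagram 2 6) : Diagram 2 6 :=
  ![actPropagator g (W (rowSwap g W 0)), actPropagator g (W (rowSwap g W 1))]

/-- The action on moves, for a given permutation of rows. -/
def actMove (g : Fin 6 × Bool) (s : Fin 2 → Fin 2) : Move 2 6 → Move 2 6
  | .leave b v => .leave (s b) (actVertex g v)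
  | .touch e a b =>
    if g.2 then .touch (actEdge g e) (s b) (s a) else .touch (actEdge g e) (s a) (s b)

/-- The action on boundary diagrams. -/
def act (g : Fin 6 × Bool) (x : Diagram 2 6 × Move 2 6) : Diagram 2 6 × Move 2 6 :=
  (actDiagram g x.1, actMove g (rowSwap g x.1) x.2)

theorem actVertex_injective (g : Fin 6 × Bool) : Function.Injective (actVertex g) := by
  intro a b h
  unfold actVertex at h
  split_ifs at h
  · exact sub_right_injective h
  · exact add_right_injective _ h

theorem actEdge_injective (g : Fin 6 × Bool) : Function.Injective (actEdge g) := by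
  intro a b h
  unfold actEdge at h
  split_ifs at h
  · exact sub_right_injective (sub_left_injective h)
  · exact add_right_injective _ h

theorem rowSwap_eq (g : Fin 6 × Bool) (W : Diagram 2 6) :
    rowSwap g W = id ∨ rowSwap g W = ![1, 0] := by
  unfold rowSwap
  split_ifs <;> simp

theorem rowSwap_injective (g : Fin 6 × Bool) (W : Diagram 2 6) :
    Function.Injective (rowSwap g W) := by
  rcases rowSwap_eq g W with h | h <;> rw [h]
  · exact Function.injective_id
  · decide

theorem actDiagram_rowSwap (g : Fin 6 × Bool) (W : Diagram 2 6) (b : Fin 2) :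
    actDiagram g W (rowSwap g W b) = actPropagator g (W b) := by
  unfold actDiagram
  rcases rowSwap_eq g W with h | h <;> rw [h] <;> fin_cases b <;> rfl

theorem actMove_injective (g : Fin 6 × Bool) {s : Fin 2 → Fin 2} (hs : Function.Injective s) :
    Function.Injective (actMove g s) := by
  intro D D' h
  cases D <;> cases D' <;> unfold actMove at h <;> dsimp only at h
  · simp only [Move.leave.injEq] at h
    rw [hs h.1, actVertex_injective g h.2]
  · split_ifs at h
  · split_ifs at h
  · split_ifs at h <;> simp only [Move.touch.injEq] at h
    · rw [actEdge_injective g h.1, hs h.2.1, hs h.2.2]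
    · rw [actEdge_injective g h.1, hs h.2.1, hs h.2.2]

/-- A reflection exchanges the two columns of the touching minor, and `actMove` exchanges its two
rows as well, so no sign appears. -/
theorem delta_actMove (g : Fin 6 × Bool) (s : Fin 2 → Fin 2) (D : Move 2 6)
    (C : Matrix (Fin 2) (Fin 6) ℝ) :
    (actMove g s D).delta C = D.delta (C.submatrix s (actVertex g)) := by
  cases D with
  | leave b v => rfl
  | touch e a b =>
    by_cases h : g.2
    · simp only [actMove, h, if_true, Move.delta, Matrix.submatrix_apply, actVertex, actEdge,
        ← sub_sub, sub_add_cancel]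
      ring
    · simp [actMove, h, Move.delta, Matrix.submatrix_apply, actVertex, actEdge, add_assoc]

theorem deltaDeriv_actMove (g : Fin 6 × Bool) (s : Fin 2 → Fin 2) (D : Move 2 6)
    (C C' : Matrix (Fin 2) (Fin 6) ℝ) :
    (actMove g s D).deltaDeriv C C' =
      D.deltaDeriv (C.submatrix s (actVertex g)) (C'.submatrix s (actVertex g)) := by
  cases D with
  | leave b v => rfl
  | touch e a b =>
    by_cases h : g.2
    · simp only [actMove, h, if_true, Move.deltaDeriv, Matrix.submatrix_apply, actVertex, actEdge,
        ← sub_sub, sub_add_cancel]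
      ring
    · simp [actMove, h, Move.deltaDeriv, Matrix.submatrix_apply, actVertex, actEdge, add_assoc]

/-- Only Klein four-group permutations of the vertex list occur: a reflection reverses both edges,
and reordering the two edges is a double transposition. All are even, so brackets keep their sign.
-/
theorem vertexList_actPropagator : ∀ (g : Fin 6 × Bool) (p : Fin 6 × Fin 6), p.1 < p.2 →
    Function.Injective (vertexList p) →
    ∃ π ∈ [1, Equiv.swap 0 2 * Equiv.swap 1 3, Equiv.swap 0 1 * Equiv.swap 2 3,
      Equiv.swap 0 3 * Equiv.swap (1 : Fin 4) 2],
      ∀ s, vertexList (actPropagator g p) s = actVertex g (vertexList p (π s)) := by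
  decide +kernel

theorem exists_perm_vertexList (g : Fin 6 × Bool) {p : Propagator 6} (h : p.1 < p.2)
    (hp : Function.Injective (vertexList p)) : ∃ π : Equiv.Perm (Fin 4), π.sign = 1 ∧
      ∀ s, vertexList (actPropagator g p) s = actVertex g (vertexList p (π s)) := by
  obtain ⟨π, hπ, hs⟩ := vertexList_actPropagator g p h hp
  refine ⟨π, ?_, hs⟩
  revert π
  simp only [List.forall_mem_cons]
  refine ⟨fun _ => ?_, fun _ => ?_, fun _ => ?_, fun _ => ?_, by simp⟩ <;> decide

variable (Z : Fin 6 → Fin 4 → ℝ) (z u : Fin 4 → ℝ) (g : Fin 6 × Bool)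

theorem bracket_actPropagator {p : Propagator 6} (h : p.1 < p.2)
    (hp : Function.Injective (vertexList p)) :
    bracket Z (actPropagator g p) = bracket (Z ∘ actVertex g) p := by
  obtain ⟨π, hπ, hs⟩ := exists_perm_vertexList g h hp
  have := Matrix.det_permute π (Matrix.of fun s => (Z ∘ actVertex g) (vertexList p s))
  rw [hπ] at this
  simp only [Units.val_one, Int.cast_one, one_mul] at this
  rw [bracket, bracket, ← this]
  congr 1
  ext i j
  simp [hs]

theorem gaugeBracket_actPropagator {p : Propagator 6} (h : p.1 < p.2)
    (hp : Function.Injective (vertexList p)) (a : Fin 6) :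
    gaugeBracket Z z (actPropagator g p) (actVertex g a) =
      gaugeBracket (Z ∘ actVertex g) z p a := by
  obtain ⟨π, hπ, hs⟩ := exists_perm_vertexList g h hp
  have := Matrix.det_permute π (Matrix.of fun s =>
    if vertexList p s = a then z else (Z ∘ actVertex g) (vertexList p s))
  rw [hπ] at this
  simp only [Units.val_one, Int.cast_one, one_mul] at this
  rw [gaugeBracket, gaugeBracket, ← this]
  congr 1
  ext i j
  simp [hs, (actVertex_injective g).eq_iff]

theorem mem_support_actPropagator {p : Propagator 6} (h : p.1 < p.2)
    (hp : Function.Injective (vertexList p)) (a : Fin 6) :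
    actVertex g a ∈ support (actPropagator g p) ↔ a ∈ support p := by
  obtain ⟨π, -, hs⟩ := exists_perm_vertexList g h hp
  simp only [support_eq_image, Finset.mem_image, Finset.mem_univ, true_and, hs,
    (actVertex_injective g).eq_iff]
  exact ⟨fun ⟨s, hs⟩ => ⟨π s, hs⟩, fun ⟨s, hs⟩ => ⟨π.symm s, by simpa using hs⟩⟩

theorem row_actPropagator {p : Propagator 6} (h : p.1 < p.2)
    (hp : Function.Injective (vertexList p)) (a : Fin 6) :
    row Z z (actPropagator g p) (actVertex g a) = row (Z ∘ actVertex g) z p a := by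
  simp only [row, mem_support_actPropagator g h hp, gaugeBracket_actPropagator Z z g h hp,
    bracket_actPropagator Z g h hp]

theorem localized_actDiagram {W : Diagram 2 6} (hW : ∀ b, (W b).1 < (W b).2)
    (hp : ∀ b, Function.Injective (vertexList (W b))) :
    (localized (actDiagram g W) Z z).submatrix (rowSwap g W) (actVertex g) =
      localized W (Z ∘ actVertex g) z := by
  ext b a
  rw [Matrix.submatrix_apply, localized_apply, localized_apply, actDiagram_rowSwap,
    row_actPropagator Z z g (hW b) (hp b)]

variable {V : Type*} [AddCommGroup V] [Module ℝ V] (φ : Fin 2 → Fin 4 → V) (η : Fin 6 → Fin 4 → V)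

theorem numer_swap (x y : Fin 6 → ℝ) : numer φ η y x = numer φ η x y := by
  simpa [show (-1 : ℝ) ^ 4 = 1 by norm_num] using numer_comb φ η x y 0 1 1 0

theorem numer_comp_actVertex (x y : Fin 6 → ℝ) :
    numer φ η x y = numer φ (η ∘ actVertex g) (x ∘ actVertex g) (y ∘ actVertex g) := by
  have h : ∀ (f : Fin 4 → V) (x : Fin 6 → ℝ),
      rowForm f η x = rowForm f (η ∘ actVertex g) (x ∘ actVertex g) := by
    intro f x
    unfold rowForm
    refine Finset.sum_congr rfl fun A _ => ?_
    congr 2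
    exact ((Equiv.ofBijective _ (Finite.injective_iff_bijective.1 (actVertex_injective g))).sum_comp
      fun a => x a • η a A).symm
  rw [numer, numer, ← h, ← h]

/-- Relabelling the hexagon amounts to relabelling the external data. A possible exchange of the two
rows is harmless because `numer` is symmetric in them (`numer_swap`); this is why `φ` stays fixed.
-/
theorem residue_act {x : Diagram 2 6 × Move 2 6} (hW : ∀ b, (x.1 b).1 < (x.1 b).2)
    (hp : ∀ b, Function.Injective (vertexList (x.1 b)))
    (hb : boundaries (actDiagram g x.1) = (boundaries x.1).image (actMove g (rowSwap g x.1))) :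
    residue φ η Z z u (act g x) = residue φ (η ∘ actVertex g) (Z ∘ actVertex g) z u x := by
  obtain ⟨W, D⟩ := x
  simp only at hW hp hb
  have hloc := fun z => localized_actDiagram Z z g hW hp
  have hinj := actMove_injective g (rowSwap_injective g W)
  have hprod : ∏ b, bracket Z (actDiagram g W b) = ∏ b, bracket (Z ∘ actVertex g) (W b) := by
    simp only [← fun b => bracket_actPropagator Z g (hW b) (hp b), ← actDiagram_rowSwap]
    exact ((Equiv.ofBijective _ (Finite.injective_iff_bijective.1
      (rowSwap_injective g W))).prod_comp fun b => bracket Z (actDiagram g W b)).symm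
  have hcof : ∀ C, cofactor (actDiagram g W, actMove g (rowSwap g W) D) C =
      cofactor (W, D) (C.submatrix (rowSwap g W) (actVertex g)) := by
    intro C
    unfold cofactor
    simp only
    rw [hb, ← Finset.image_erase hinj, Finset.prod_image hinj.injOn]
    simp only [delta_actMove]
  have hnum : ∀ C : Matrix (Fin 2) (Fin 6) ℝ, numer φ η (C 0) (C 1) =
      numer φ (η ∘ actVertex g) (C.submatrix (rowSwap g W) (actVertex g) 0)
        (C.submatrix (rowSwap g W) (actVertex g) 1) := by
    intro C
    rcases rowSwap_eq g W with h | h <;> rw [h]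
    · exact numer_comp_actVertex g φ η _ _
    · rw [← numer_swap]
      exact numer_comp_actVertex g φ η _ _
  simp only [residue, act, delta_actMove, deltaDeriv_actMove, hloc, hcof, hprod, hnum]

theorem transversal_of_act {x : Diagram 2 6 × Move 2 6} (hW : ∀ b, (x.1 b).1 < (x.1 b).2)
    (hp : ∀ b, Function.Injective (vertexList (x.1 b)))
    (hb : boundaries (actDiagram g x.1) = (boundaries x.1).image (actMove g (rowSwap g x.1)))
    (h : Transversal (act g x).1 (act g x).2 Z z u) :
    Transversal x.1 x.2 (Z ∘ actVertex g) z u := by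
  obtain ⟨W, D⟩ := x
  simp only [act] at hW hp hb h ⊢
  have hloc := fun z => localized_actDiagram Z z g hW hp
  have hinj := actMove_injective g (rowSwap_injective g W)
  refine ⟨fun D' hD' hne => ?_, ?_⟩
  · have := h.1 (actMove g (rowSwap g W) D') (by rw [hb]; exact Finset.mem_image_of_mem _ hD')
      (hinj.ne hne)
    rwa [delta_actMove, hloc] at this
  · have := h.2
    simpa only [delta_actMove, hloc] using this

end Dihedral

/-! ### Enumeration of the diagrams and of their boundary diagrams -/

section Enumeration

/-- A bounded quantifier over a list is decided by running through the list. -/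
local instance decidableForallMemList {α : Type*} (l : List α) (p : α → Prop) [DecidablePred p] :
    Decidable (∀ x ∈ l, p x) := List.decidableBAll p l

/-- The admissible diagrams with two propagators on the hexagon. -/
def admissibleList : List (Diagram 2 6) :=
  [![(0, 2), (2, 4)], ![(0, 2), (2, 5)], ![(0, 2), (3, 5)], ![(0, 3), (0, 2)], ![(0, 3), (1, 3)],
   ![(0, 3), (3, 5)], ![(0, 4), (0, 2)], ![(0, 4), (0, 3)], ![(0, 4), (1, 3)], ![(0, 4), (1, 4)],
   ![(0, 4), (2, 4)], ![(1, 3), (3, 5)], ![(1, 4), (1, 3)], ![(1, 4), (2, 4)], ![(1, 5), (1, 3)],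
   ![(1, 5), (1, 4)], ![(1, 5), (2, 4)], ![(1, 5), (2, 5)], ![(1, 5), (3, 5)], ![(2, 5), (2, 4)],
   ![(2, 5), (3, 5)]]

theorem admissible_of_mem : ∀ W ∈ admissibleList, Admissible W := by decide +kernel

set_option synthInstance.maxSize 2000 in
set_option synthInstance.maxHeartbeats 200000 in
-- Admissibility unfolded for two propagators, with the support condition stated for the two
-- singletons and the whole set, so that the search runs over pairs of edges instead of functions.
theorem mem_admissibleList_of_pair : ∀ p q : Fin 6 × Fin 6, p.1 < p.2 → q.1 < q.2 →
    (p.1 < q.1 ∨ (p.1 = q.1 ∧ q.2 < p.2)) → ¬ Crosses p q → 4 ≤ (support p).card →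
    4 ≤ (support q).card → 5 ≤ (support p ∪ support q).card → ![p, q] ∈ admissibleList := by
  simp only [Crosses, Prod.forall]
  decide +kernel

theorem mem_admissibleList {W : Diagram 2 6} (h : Admissible W) : W ∈ admissibleList := by
  obtain ⟨⟨h1, h2⟩, -, h3, h4⟩ := h
  have hW : W = ![W 0, W 1] := by
    ext b : 1
    fin_cases b <;> rfl
  rw [hW]
  refine mem_admissibleList_of_pair _ _ (h1 0) (h1 1) (h2 0 1 (by decide)) (h4 0 1) ?_ ?_ ?_
  · simpa using h3 {0} (by simp)
  · simpa using h3 {1} (by simp)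
  · have := h3 {0, 1} (by simp)
    simpa [Finset.biUnion_insert] using this

theorem lt_and_injective_of_mem : ∀ W ∈ admissibleList, ∀ b,
    (W b).1 < (W b).2 ∧ Function.Injective (vertexList (W b)) := by
  decide +kernel

/-- The boundary diagrams of a diagram with two propagators in which an end on the edge `e` has
moved. -/
def edgeMoveList (W : Diagram 2 6) (e : Fin 6) : List (Move 2 6) :=
  if Incident W e 0 then
    if Incident W e 1 then
      if otherEdge e (W 1) - e < otherEdge e (W 0) - e then
        [.leave 1 e, .leave 0 (e + 1), .touch e 0 1]
      else [.leave 0 e, .leave 1 (e + 1), .touch e 1 0]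
    else [.leave 0 e, .leave 0 (e + 1)]
  else if Incident W e 1 then [.leave 1 e, .leave 1 (e + 1)] else []

/-- The boundary diagrams of a diagram with two propagators. -/
def moveList (W : Diagram 2 6) : List (Move 2 6) :=
  edgeMoveList W 0 ++ edgeMoveList W 1 ++ edgeMoveList W 2 ++ edgeMoveList W 3 ++
    edgeMoveList W 4 ++ edgeMoveList W 5

theorem edgeMoves_eq : ∀ W ∈ admissibleList, ∀ e,
    edgeMoves W e = (edgeMoveList W e).toFinset := by
  decide +kernel

theorem boundaries_eq {W : Diagram 2 6} (hW : W ∈ admissibleList) :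
    boundaries W = (moveList W).toFinset := by
  ext D
  simp [boundaries_eq_biUnion, edgeMoves_eq W hW, moveList, Fin.exists_fin_succ]

/-- All elements of the dihedral group. -/
def dihedralList : List (Fin 6 × Bool) :=
  [(0, false), (1, false), (2, false), (3, false), (4, false), (5, false),
   (0, true), (1, true), (2, true), (3, true), (4, true), (5, true)]

/-- Representatives of the orbits of the dihedral group on the minimal sets of boundary diagrams on
which the residues add up to zero, together with representatives of the cosets of their
stabilizers. -/
def orbitTable : List (List (Diagram 2 6 × Move 2 6) × List (Fin 6 × Bool)) :=
  [([(![(0, 2), (2, 4)], .touch 2 0 1), (![(0, 4), (0, 2)], .touch 0 0 1),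
      (![(0, 4), (2, 4)], .touch 4 1 0)], dihedralList.take 2),
   ([(![(0, 2), (2, 4)], .leave 1 5), (![(0, 3), (0, 2)], .touch 0 0 1),
      (![(0, 3), (1, 3)], .leave 1 1)], dihedralList),
   ([(![(0, 2), (2, 4)], .leave 1 2), (![(0, 2), (3, 5)], .leave 1 0)], dihedralList),
   ([(![(0, 2), (2, 4)], .leave 0 1), (![(2, 5), (2, 4)], .leave 0 5)], dihedralList),
   ([(![(0, 2), (3, 5)], .leave 0 1), (![(2, 5), (3, 5)], .leave 0 5)], dihedralList),
   ([(![(0, 2), (2, 5)], .leave 0 3), (![(1, 5), (2, 5)], .leave 0 5)], dihedralList.take 6),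
   ([(![(0, 2), (2, 5)], .leave 0 1)], dihedralList),
   ([(![(0, 2), (2, 5)], .leave 1 5)], dihedralList)]

/-- All minimal sets of boundary diagrams on which the residues add up to zero. -/
def cancellingSets : List (List (Diagram 2 6 × Move 2 6)) :=
  orbitTable.flatMap fun o => o.2.map fun g => o.1.map (act g)

theorem mem_of_mem_cancellingSets : ∀ c ∈ cancellingSets, ∀ x ∈ c,
    x.1 ∈ admissibleList ∧ x.2 ∈ moveList x.1 := by
  decide +kernel

theorem mem_of_mem_representative : ∀ o ∈ orbitTable, ∀ x ∈ o.1,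
    x.1 ∈ admissibleList ∧ x.2 ∈ moveList x.1 := by
  decide +kernel

theorem moveList_nodup : ∀ W ∈ admissibleList, (moveList W).Nodup := by
  decide +kernel

/-- Inclusion plus equal length suffices: `actMove` is injective, so `boundaries_actDiagram` obtains
equality by counting. -/
theorem actMove_mem : ∀ o ∈ orbitTable, ∀ g ∈ o.2, ∀ x ∈ o.1,
    (∀ D ∈ moveList x.1, actMove g (rowSwap g x.1) D ∈ moveList (actDiagram g x.1)) ∧
      (moveList x.1).length = (moveList (actDiagram g x.1)).length := by
  decide +kernel

/-- With `nodup_flatten_cancellingSets`, this says that the cancelling sets partition all pairs of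
an admissible diagram and a boundary of it. -/
theorem mem_flatten_cancellingSets : ∀ W ∈ admissibleList, ∀ D ∈ moveList W,
    (W, D) ∈ cancellingSets.flatten := by
  decide +kernel

theorem nodup_flatten_cancellingSets : cancellingSets.flatten.Nodup := by
  decide +kernel

/-! ### A combinatorial criterion for the bases of a boundary diagram -/

/-- The minor in the columns `i` and `j` does not vanish identically on the matrices of the boundary
diagram `D` of `W`. -/
def IsMoveBasis (W : Diagram 2 6) : Move 2 6 → Fin 6 → Fin 6 → Prop
  | .leave b v, i, j =>
    (i ∈ support (W 0) ∧ j ∈ support (W 1) ∧ ¬(0 = b ∧ i = v) ∧ ¬(1 = b ∧ j = v)) ∨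
      (j ∈ support (W 0) ∧ i ∈ support (W 1) ∧ ¬(0 = b ∧ j = v) ∧ ¬(1 = b ∧ i = v))
  | .touch e _ _, i, j =>
    ((i ∈ support (W 0) ∧ j ∈ support (W 1)) ∨ (j ∈ support (W 0) ∧ i ∈ support (W 1))) ∧
      ¬(e = i ∧ e + 1 = j) ∧ ¬(e = j ∧ e + 1 = i)

instance (W : Diagram 2 6) (D : Move 2 6) (i j : Fin 6) : Decidable (IsMoveBasis W D i j) := by
  cases D <;> unfold IsMoveBasis <;> infer_instance

theorem maxMinor_two {n : ℕ} (C : Matrix (Fin 2) (Fin n) ℝ) (I : Fin 2 ↪o Fin n) :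
    maxMinor C I = C 0 (I 0) * C 1 (I 1) - C 0 (I 1) * C 1 (I 0) := by
  rw [maxMinor, Matrix.det_fin_two]
  rfl

/-- The matrix with entries one at `(0, i)` and `(1, j)` and zeros elsewhere. -/
def twoEntries {n : ℕ} (i j : Fin n) : Matrix (Fin 2) (Fin n) ℝ :=
  Matrix.of ![Pi.single i 1, Pi.single j 1]

theorem delta_twoEntries {D : Move 2 6} {i j : Fin 6}
    (hD : ∀ e a b, D = .touch e a b → a ≠ b) (hl : ∀ b v, D = .leave b v →
      ¬(0 = b ∧ i = v) ∧ ¬(1 = b ∧ j = v))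
    (ht : ∀ e a b, D = .touch e a b → ¬(e = i ∧ e + 1 = j) ∧ ¬(e = j ∧ e + 1 = i)) :
    D.delta (twoEntries i j) = 0 := by
  cases D with
  | leave b v =>
    have := hl b v rfl
    fin_cases b <;> simp_all [Move.delta, twoEntries, Pi.single_apply, eq_comm]
  | touch e a b =>
    have h1 := hD e a b rfl
    have h2 := ht e a b rfl
    fin_cases a <;> fin_cases b <;>
      simp_all [Move.delta, twoEntries, Pi.single_apply] <;> grind

/-- A nonzero 2 × 2 minor has a nonzero product of two entries, which forces the incidences.
Conversely a matrix with just two nonzero entries realizes the minor and satisfies Δ = 0. In the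
touching case the only minor lost is the one in the columns `e`, `e + 1`, which is Δ up to sign. -/
theorem mem_boundaryBases_iff {W : Diagram 2 6} {D : Move 2 6}
    (hD : ∀ e a b, D = .touch e a b → a ≠ b) (I : Fin 2 ↪o Fin 6) :
    I ∈ boundaryBases W D ↔ IsMoveBasis W D (I 0) (I 1) := by
  have hI : I 0 ≠ I 1 := I.injective.ne (by decide)
  have hshape : ∀ {i j : Fin 6}, i ∈ support (W 0) → j ∈ support (W 1) →
      HasShape W (twoEntries i j) := by
    intro i j hi hj b a ha
    fin_cases b
    · exact Pi.single_eq_of_ne (by rintro rfl; exact ha hi) _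
    · exact Pi.single_eq_of_ne (by rintro rfl; exact ha hj) _
  have hminor : maxMinor (twoEntries (I 0) (I 1)) I ≠ 0 ∧
      maxMinor (twoEntries (I 1) (I 0)) I ≠ 0 := by
    simp [maxMinor_two, twoEntries, hI, hI.symm]
  constructor
  · rintro ⟨C, hC, hd, hm⟩
    rw [maxMinor_two] at hm
    have key : ∀ {b a}, C b a ≠ 0 → a ∈ support (W b) := fun {b a} h => by
      by_contra ha
      exact h (hC b a ha)
    have hor : (C 0 (I 0) ≠ 0 ∧ C 1 (I 1) ≠ 0) ∨ (C 0 (I 1) ≠ 0 ∧ C 1 (I 0) ≠ 0) := by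
      by_contra h
      apply hm
      grind
    cases D with
    | leave b v =>
      have hd' : C b v = 0 := hd
      unfold IsMoveBasis
      rcases hor with ⟨h1, h2⟩ | ⟨h1, h2⟩
      · exact Or.inl ⟨key h1, key h2, by rintro ⟨rfl, rfl⟩; exact h1 hd',
          by rintro ⟨rfl, rfl⟩; exact h2 hd'⟩
      · exact Or.inr ⟨key h1, key h2, by rintro ⟨rfl, rfl⟩; exact h1 hd',
          by rintro ⟨rfl, rfl⟩; exact h2 hd'⟩
    | touch e a b =>
      have hab := hD e a b rfl
      have hd' : C 0 e * C 1 (e + 1) - C 0 (e + 1) * C 1 e = 0 := by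
        have : C a e * C b (e + 1) - C b e * C a (e + 1) = 0 := hd
        fin_cases a <;> fin_cases b <;> simp at hab this ⊢ <;> linarith
      refine ⟨hor.imp (fun h => ⟨key h.1, key h.2⟩) (fun h => ⟨key h.1, key h.2⟩), ?_, ?_⟩
      · rintro ⟨rfl, h⟩
        rw [h] at hd'
        exact hm hd'
      · rintro ⟨rfl, h⟩
        rw [h] at hd'
        exact hm (by linarith)
  · intro h
    cases D with
    | leave b v =>
      rcases h with ⟨h1, h2, h3, h4⟩ | ⟨h1, h2, h3, h4⟩
      · exact ⟨_, hshape h1 h2, delta_twoEntries hD (by grind) (by simp), hminor.1⟩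
      · exact ⟨_, hshape h1 h2, delta_twoEntries hD (by grind) (by simp), hminor.2⟩
    | touch e a b =>
      rcases h with ⟨⟨h1, h2⟩ | ⟨h1, h2⟩, h3, h4⟩
      · exact ⟨_, hshape h1 h2, delta_twoEntries hD (by simp) (by grind), hminor.1⟩
      · exact ⟨_, hshape h1 h2, delta_twoEntries hD (by simp) (by grind), hminor.2⟩

theorem isMoveBasis_iff : ∀ c ∈ cancellingSets, ∀ x ∈ c, ∀ y ∈ c, ∀ i j, i < j →
    (IsMoveBasis x.1 x.2 i j ↔ IsMoveBasis y.1 y.2 i j) := by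
  decide +kernel

theorem touch_ne : ∀ W ∈ admissibleList, ∀ D ∈ moveList W, ∀ e a, D ≠ .touch e a a := by
  decide +kernel

end Enumeration

/-! ### Cancellation of residues -/

section Cancellation

variable {Z : Fin 6 → Fin 4 → ℝ} {z u : Fin 4 → ℝ}
  {V : Type*} [AddCommGroup V] [Module ℝ V] {φ : Fin 2 → Fin 4 → V} {η : Fin 6 → Fin 4 → V}

theorem mem_boundaries_iff {W : Diagram 2 6} (hW : W ∈ admissibleList) {D : Move 2 6} :
    D ∈ boundaries W ↔ D ∈ moveList W := by
  rw [boundaries_eq hW, List.mem_toFinset]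

theorem cofactor_eq {W : Diagram 2 6} {D : Move 2 6} {l : List (Move 2 6)}
    (hW : W ∈ admissibleList) (h : (moveList W).erase D = l) (C : Matrix (Fin 2) (Fin 6) ℝ) :
    cofactor (W, D) C = (l.map fun D' => D'.delta C).prod := by
  have hn := moveList_nodup W hW
  have : (boundaries W).erase D = l.toFinset := by
    ext D'
    rw [boundaries_eq hW, ← h]
    simp [hn.mem_erase_iff]
  rw [cofactor, this, List.prod_toFinset _ (h ▸ hn.erase D)]

theorem delta_ne_zero_of_transversal {W : Diagram 2 6} {D D' : Move 2 6}
    (h : Transversal W D Z z u) (hW : W ∈ admissibleList) (hD' : D' ∈ (moveList W).erase D) :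
    D'.delta (localized W Z z) ≠ 0 := by
  rw [(moveList_nodup W hW).mem_erase_iff] at hD'
  exact h.1 D' ((mem_boundaries_iff hW).2 hD'.2) hD'.1

/-- If two propagators share a support on the locus where one of them loses a vertex, then this
locus meets another polar locus. -/
theorem residue_eq_zero_of_touch {W : Diagram 2 6} {b : Fin 2} {v e : Fin 6}
    (hZ : GeneralPosition Z) (hW : W ∈ admissibleList)
    (htr : Transversal W (.leave b v) Z z u)
    (hs : ∀ a ∈ support (W b), a ≠ v → a ∈ support (W (1 - b)))
    (ht : .touch e 0 1 ∈ (moveList W).erase (.leave b v)) :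
    residue φ η Z z u (W, .leave b v) = 0 := by
  refine if_neg fun h0 => ?_
  have h0' : row Z z (W b) v = 0 := h0
  have hinj := fun b => (lt_and_injective_of_mem W hW b).2
  -- With its entry at `v` gone, the row of `W b` is supported on the other propagator and still
  -- represents `-z`, so it must be the other row.
  have heq : row Z z (W b) = row Z z (W (1 - b)) := by
    refine eq_row hZ (hinj _) (fun a ha => ?_) (sum_row Z hZ z (hinj b))
    by_cases hav : a = v
    · rw [hav, h0']
    · exact row_of_notMem fun h => ha (hs a h hav)
  have hrow : row Z z (W 0) = row Z z (W 1) := by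
    fin_cases b
    · exact heq
    · exact heq.symm
  refine delta_ne_zero_of_transversal htr hW ht ?_
  simp [Move.delta, localized_apply, hrow]

/-! ### Two-term cancellation: propagators that lose different vertices and keep the same three -/

/-- Two brackets with one vertex replaced by the gauge vector agree up to the sign of the
permutation that matches their rows. -/
theorem gaugeBracket_perm {q q' : Propagator 6} {v v' : Fin 6} (π : Equiv.Perm (Fin 4))
    (h : ∀ s, (if vertexList q s = v then none else some (vertexList q s)) =
      if vertexList q' (π s) = v' then none else some (vertexList q' (π s))) :
    gaugeBracket Z z q v = π.sign * gaugeBracket Z z q' v' := by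
  rw [gaugeBracket, gaugeBracket, ← Matrix.det_permute]
  congr 1
  ext s j
  have := h s
  simp only [Matrix.of_apply, Matrix.submatrix_apply, id]
  split_ifs at this ⊢ with h1 h2 h2
  · rfl
  · rw [Option.some.inj this]

/-- The propagator `q` without the vertex `v` and the propagator `q'` without the vertex `v'` have
the same support, and the brackets of the remaining vertices have opposite signs. -/
structure Slides (q q' : Propagator 6) (v v' : Fin 6) : Prop where
  injective : Function.Injective (vertexList q)
  injective' : Function.Injective (vertexList q')
  mem : v ∈ support q
  mem' : v' ∈ support q'
  mem_of_ne : ∀ a ∈ support q, a ≠ v → a ∈ support q'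
  perm : ∃ π : Equiv.Perm (Fin 4), π.sign = -1 ∧ ∀ s,
    (if vertexList q s = v then none else some (vertexList q s)) =
      if vertexList q' (π s) = v' then none else some (vertexList q' (π s))

namespace Slides

variable {q q' : Propagator 6} {v v' : Fin 6}

theorem gaugeBracket_eq (h : Slides q q' v v') (z : Fin 4 → ℝ) :
    gaugeBracket Z z q v = -gaugeBracket Z z q' v' := by
  obtain ⟨π, hπ, hs⟩ := h.perm
  rw [gaugeBracket_perm π hs]
  simp [hπ]

/-- By Cramer's rule both sides are, up to sign, the determinant of `z` with the three common
vertices. Applied at `z` it equates the polar loci; applied at `u` it makes the derivatives of the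
two Δ opposite once weighted by the brackets. -/
theorem bracket_mul_row_eq (h : Slides q q' v v') (hZ : GeneralPosition Z) (z : Fin 4 → ℝ) :
    bracket Z q * row Z z q v = -(bracket Z q' * row Z z q' v') := by
  rw [bracket_mul_row Z hZ z h.injective h.mem, bracket_mul_row Z hZ z h.injective' h.mem',
    h.gaugeBracket_eq]

theorem row_eq_zero_iff (h : Slides q q' v v') (hZ : GeneralPosition Z) (z : Fin 4 → ℝ) :
    row Z z q v = 0 ↔ row Z z q' v' = 0 := by
  have h1 := h.bracket_mul_row_eq hZ z
  have hq := bracket_ne_zero hZ h.injective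
  have hq' := bracket_ne_zero hZ h.injective'
  constructor <;> intro h0 <;> rw [h0] at h1 <;> simpa [hq, hq'] using h1

theorem row_eq (h : Slides q q' v v') (hZ : GeneralPosition Z) {z : Fin 4 → ℝ}
    (h0 : row Z z q v = 0) : row Z z q = row Z z q' := by
  refine eq_row hZ h.injective' (fun a ha => ?_) (sum_row Z hZ z h.injective)
  by_cases hav : a = v
  · rw [hav, h0]
  · exact row_of_notMem fun hq => ha (h.mem_of_ne a hq hav)

end Slides

theorem residue_of_eq_zero {W : Diagram 2 6} {D : Move 2 6} (h : D.delta (localized W Z z) = 0) :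
    residue φ η Z z u (W, D) =
      ((bracket Z (W 0) * bracket Z (W 1)) * cofactor (W, D) (localized W Z z) *
        D.deltaDeriv (localized W Z z) (localized W Z u))⁻¹ •
        numer φ η (row Z z (W 0)) (row Z z (W 1)) := by
  rw [residue, if_pos h, Fin.prod_univ_two]
  rfl

theorem residue_of_ne_zero {W : Diagram 2 6} {D : Move 2 6} (h : D.delta (localized W Z z) ≠ 0) :
    residue φ η Z z u (W, D) = 0 := if_neg h

/-- On the polar locus the sliding rows coincide, so the numerators agree, and `hcof` asserts the
same for the other factors. What remains is the sign in `Slides.bracket_mul_row_eq` at `u`. -/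
theorem residue_add_slide_snd {p q q' : Propagator 6} {v v' : Fin 6} (hZ : GeneralPosition Z)
    (h : Slides q q' v v')
    (hcof : row Z z q v = 0 → row Z z q' v' = 0 → row Z z q = row Z z q' →
      cofactor (![p, q], .leave 1 v) (localized ![p, q] Z z) =
        cofactor (![p, q'], .leave 1 v') (localized ![p, q'] Z z)) :
    residue φ η Z z u (![p, q], .leave 1 v) + residue φ η Z z u (![p, q'], .leave 1 v') = 0 := by
  have hiff := h.row_eq_zero_iff hZ z
  have hu := h.bracket_mul_row_eq hZ u
  by_cases h0 : row Z z q v = 0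
  · rw [residue_of_eq_zero (W := ![p, q]) (D := .leave 1 v) h0,
      residue_of_eq_zero (W := ![p, q']) (D := .leave 1 v') (hiff.1 h0)]
    simp only [Move.deltaDeriv, localized_apply, Matrix.cons_val_zero, Matrix.cons_val_one]
    rw [hcof h0 (hiff.1 h0) (h.row_eq hZ h0), h.row_eq hZ h0, ← add_smul]
    convert zero_smul ℝ _
    rw [add_eq_zero_iff_eq_neg, ← inv_neg]
    congr 1
    linear_combination bracket Z p *
      cofactor (![p, q'], .leave 1 v') (localized ![p, q'] Z z) * hu
  · rw [residue_of_ne_zero (W := ![p, q]) (D := .leave 1 v) h0,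
      residue_of_ne_zero (W := ![p, q']) (D := .leave 1 v') (hiff.not.1 h0), add_zero]

theorem residue_add_slide_fst {p q q' : Propagator 6} {v v' : Fin 6} (hZ : GeneralPosition Z)
    (h : Slides q q' v v')
    (hcof : row Z z q v = 0 → row Z z q' v' = 0 → row Z z q = row Z z q' →
      cofactor (![q, p], .leave 0 v) (localized ![q, p] Z z) =
        cofactor (![q', p], .leave 0 v') (localized ![q', p] Z z)) :
    residue φ η Z z u (![q, p], .leave 0 v) + residue φ η Z z u (![q', p], .leave 0 v') = 0 := by
  have hiff := h.row_eq_zero_iff hZ z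
  have hu := h.bracket_mul_row_eq hZ u
  by_cases h0 : row Z z q v = 0
  · rw [residue_of_eq_zero (W := ![q, p]) (D := .leave 0 v) h0,
      residue_of_eq_zero (W := ![q', p]) (D := .leave 0 v') (hiff.1 h0)]
    simp only [Move.deltaDeriv, localized_apply, Matrix.cons_val_zero, Matrix.cons_val_one]
    rw [hcof h0 (hiff.1 h0) (h.row_eq hZ h0), h.row_eq hZ h0, ← add_smul]
    convert zero_smul ℝ _
    rw [add_eq_zero_iff_eq_neg, ← inv_neg]
    congr 1
    linear_combination bracket Z p *
      cofactor (![q', p], .leave 0 v') (localized ![q', p] Z z) * hu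
  · rw [residue_of_ne_zero (W := ![q, p]) (D := .leave 0 v) h0,
      residue_of_ne_zero (W := ![q', p]) (D := .leave 0 v') (hiff.not.1 h0), add_zero]

theorem residue_02_24_add_02_35 (hZ : GeneralPosition Z) :
    residue φ η Z z u (![(0, 2), (2, 4)], .leave 1 2) +
      residue φ η Z z u (![(0, 2), (3, 5)], .leave 1 0) = 0 := by
  refine residue_add_slide_snd hZ (by constructor <;> decide +kernel) fun h0 h0' h => ?_
  -- The common row has no entry at 2, so the touching minor on edge 2 collapses to one product,
  -- matching two separate factors of the second diagram.
  rw [h] at h0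
  rw [cofactor_eq (by decide) (l := [.leave 0 0, .leave 0 1, .leave 0 3, .touch 2 0 1, .leave 1 4, .leave 1 5])
      (by decide),
    cofactor_eq (by decide) (l := [.leave 0 0, .leave 0 1, .leave 0 2, .leave 0 3, .leave 1 3, .leave 1 4, .leave 1 5])
      (by decide)]
  simp only [List.map_cons, List.map_nil, List.prod_cons, List.prod_nil, Move.delta,
    localized_apply, Matrix.cons_val_zero, Matrix.cons_val_one, h, h0, Fin.reduceAdd]
  ring

theorem residue_02_24_add_25_24 (hZ : GeneralPosition Z) :
    residue φ η Z z u (![(0, 2), (2, 4)], .leave 0 1) +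
      residue φ η Z z u (![(2, 5), (2, 4)], .leave 0 5) = 0 := by
  refine residue_add_slide_fst hZ (by constructor <;> decide +kernel) fun h0 h0' h => ?_
  rw [h] at h0
  rw [cofactor_eq (by decide) (l := [.leave 0 0, .leave 1 2, .leave 0 3, .touch 2 0 1, .leave 1 4, .leave 1 5])
      (by decide),
    cofactor_eq (by decide) (l := [.leave 1 2, .leave 0 3, .touch 2 0 1, .leave 1 4, .leave 1 5, .leave 0 0])
      (by decide)]
  simp only [List.map_cons, List.map_nil, List.prod_cons, List.prod_nil, Move.delta,
    localized_apply, Matrix.cons_val_zero, Matrix.cons_val_one, h, Fin.reduceAdd]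
  ring

theorem residue_02_35_add_25_35 (hZ : GeneralPosition Z) :
    residue φ η Z z u (![(0, 2), (3, 5)], .leave 0 1) +
      residue φ η Z z u (![(2, 5), (3, 5)], .leave 0 5) = 0 := by
  refine residue_add_slide_fst hZ (by constructor <;> decide +kernel) fun h0 h0' h => ?_
  -- Here the touching minor on edge 5 of the second diagram collapses, because the sliding row has
  -- no entry at 5.
  rw [h] at h0
  rw [cofactor_eq (by decide) (l := [.leave 0 0, .leave 0 2, .leave 0 3, .leave 1 3, .leave 1 4, .leave 1 5, .leave 1 0])
      (by decide),
    cofactor_eq (by decide) (l := [.leave 0 2, .leave 0 3, .leave 1 3, .leave 1 4, .leave 1 0, .touch 5 1 0])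
      (by decide)]
  simp only [List.map_cons, List.map_nil, List.prod_cons, List.prod_nil, Move.delta,
    localized_apply, Matrix.cons_val_zero, Matrix.cons_val_one, h, h0', Fin.reduceAdd]
  ring

theorem residue_02_25_add_15_25 (hZ : GeneralPosition Z) :
    residue φ η Z z u (![(0, 2), (2, 5)], .leave 0 3) +
      residue φ η Z z u (![(1, 5), (2, 5)], .leave 0 5) = 0 := by
  refine residue_add_slide_fst hZ (by constructor <;> decide +kernel) fun h0 h0' h => ?_
  -- Both diagrams have a touching minor, on edge 2 and on edge 5; each collapses to a product
  -- because the common row vanishes at 3 and at 5.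
  rw [h] at h0
  rw [cofactor_eq (by decide) (l := [.leave 0 0, .leave 0 1, .leave 1 2, .touch 2 0 1, .leave 1 5, .leave 1 0])
      (by decide),
    cofactor_eq (by decide) (l := [.leave 0 1, .leave 0 2, .leave 1 2, .leave 1 3, .leave 1 0, .touch 5 1 0])
      (by decide)]
  simp only [List.map_cons, List.map_nil, List.prod_cons, List.prod_nil, Move.delta,
    localized_apply, Matrix.cons_val_zero, Matrix.cons_val_one, h, h0, h0', Fin.reduceAdd]
  ring

end Cancellation

/-! ### Volume forms, linear relations between six vectors, and three touching diagrams -/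

section Triples

/-- The determinant of four vectors, as a linear function of the last one. -/
noncomputable def vol (a b c : Fin 4 → ℝ) : (Fin 4 → ℝ) →ₗ[ℝ] ℝ where
  toFun d := (Matrix.of ![a, b, c, d]).det
  map_add' d e := by
    simp [Matrix.det_succ_row_zero, Fin.sum_univ_succ, Fin.succAbove]
    ring
  map_smul' t d := by
    simp [Matrix.det_succ_row_zero, Fin.sum_univ_succ, Fin.succAbove]
    ring

theorem vol_apply (a b c d : Fin 4 → ℝ) : vol a b c d = (Matrix.of ![a, b, c, d]).det := rfl

theorem vol_rotate (a b c d : Fin 4 → ℝ) : vol b c d a = -vol a b c d := by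
  simp [vol_apply, Matrix.det_succ_row_zero, Fin.sum_univ_succ, Fin.succAbove]
  ring

theorem vol_swap_last (a b c d : Fin 4 → ℝ) : vol a b d c = -vol a b c d := by
  simp [vol_apply, Matrix.det_succ_row_zero, Fin.sum_univ_succ, Fin.succAbove]
  ring

theorem vol_swap_mid (a b c d : Fin 4 → ℝ) : vol a c b d = -vol a b c d := by
  simp [vol_apply, Matrix.det_succ_row_zero, Fin.sum_univ_succ, Fin.succAbove]
  ring

theorem vol_self_last (a b c : Fin 4 → ℝ) : vol a b c c = 0 := by
  have := vol_swap_last a b c c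
  linarith

theorem vol_self_mid (a b c : Fin 4 → ℝ) : vol a b c b = 0 := by
  rw [vol_swap_last]
  have := vol_swap_mid a b b c
  linarith

theorem vol_self_first (a b c : Fin 4 → ℝ) : vol a b c a = 0 := by
  simp [vol_apply, Matrix.det_succ_row_zero, Fin.sum_univ_succ, Fin.succAbove]
  ring

theorem bracket_eq_vol {n : ℕ} [NeZero n] (Z : Fin n → Fin 4 → ℝ) (p : Propagator n) :
    bracket Z p = vol (Z p.1) (Z (p.1 + 1)) (Z p.2) (Z (p.2 + 1)) := by
  rw [bracket, vol_apply]
  congr 1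
  ext i j
  fin_cases i <;> rfl

theorem vol_ne_zero {n : ℕ} {Z : Fin n → Fin 4 → ℝ} (hZ : GeneralPosition Z)
    {a b c d : Fin n} (h : Function.Injective ![a, b, c, d]) :
    vol (Z a) (Z b) (Z c) (Z d) ≠ 0 := by
  have := hZ _ h
  rw [vol_apply]
  convert this using 2
  ext i j
  fin_cases i <;> rfl

/-- The `2 × 2` minors of two linear relations between six vectors are proportional to the
complementary `4 × 4` minors of the vectors. -/
theorem relation_minor {a b c d e f : Fin 4 → ℝ} {da db dc dd de df ea eb ec ed ee ef : ℝ}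
    (hd : da • a + db • b + dc • c + dd • d + de • e + df • f = 0)
    (he : ea • a + eb • b + ec • c + ed • d + ee • e + ef • f = 0) (h : vol a d e f ≠ 0) :
    (da * eb - db * ea) * vol a b e f = (dc * ed - dd * ec) * vol c d e f := by
  -- Pairing with `d, e, f` leaves the coefficients at `a, b, c`; pairing with `a, e, f` leaves
  -- those at `b, c, d`. Eliminating the cross terms gives the claim multiplied by `vol a d e f`.
  have h1 := congrArg (vol d e f) hd
  have h2 := congrArg (vol d e f) he
  have h3 := congrArg (vol a e f) hd
  have h4 := congrArg (vol a e f) he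
  simp only [map_add, map_smul, smul_eq_mul, vol_self_first, vol_self_mid, vol_self_last, map_zero,
    mul_zero, add_zero, zero_add] at h1 h2 h3 h4
  rw [vol_rotate a d e f, vol_rotate c d e f] at h1 h2
  have h5 : ∀ x, vol a e f x = vol a x e f := fun x => by
    rw [vol_swap_last, vol_swap_mid, neg_neg]
  rw [h5, h5, h5] at h3 h4
  refine mul_left_cancel₀ h ?_
  linear_combination (vol a b e f * db) * h2 - (vol a b e f * eb) * h1 +
    (vol c d e f * ec) * h3 - (vol c d e f * dc) * h4

/-! ### The three ways to bring neighbouring ends to touch -/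

variable {Z : Fin 6 → Fin 4 → ℝ} {z u : Fin 4 → ℝ}
  {V : Type*} [AddCommGroup V] [Module ℝ V] {φ : Fin 2 → Fin 4 → V} {η : Fin 6 → Fin 4 → V}

theorem row_sub_relation (hZ : GeneralPosition Z) (z : Fin 4 → ℝ) {p q : Propagator 6}
    (hp : Function.Injective (vertexList p)) (hq : Function.Injective (vertexList q)) :
    ∑ a, (row Z z p a - row Z z q a) • Z a = 0 := by
  simp only [sub_smul, Finset.sum_sub_distrib, sum_row Z hZ z hp, sum_row Z hZ z hq, sub_self]

/-- A touching minor is quadratic in the matrix and the localized matrix is linear in the gauge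
vector, so the derivative is a polarization. Identities between minors valid for all gauge vectors
thus pass to derivatives. -/
theorem deltaDeriv_touch {W : Diagram 2 6} (hZ : GeneralPosition Z) (e : Fin 6) (a b : Fin 2)
    (hp : ∀ b, Function.Injective (vertexList (W b))) :
    (Move.touch e a b).deltaDeriv (localized W Z z) (localized W Z u) =
      (Move.touch e a b).delta (localized W Z (z + u)) -
        (Move.touch e a b).delta (localized W Z z) -
        (Move.touch e a b).delta (localized W Z u) := by
  have := localized_add_smul hZ z u 1 hp
  rw [one_smul, one_smul] at this
  simp only [this, Move.delta, Move.deltaDeriv, Matrix.add_apply]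
  ring

/-- The scaled minors of three touching diagrams are equal. -/
theorem touch_minors (hZ : GeneralPosition Z) (z : Fin 4 → ℝ) :
    bracket Z (2, 4) * (row Z z (0, 2) 2 * row Z z (2, 4) 3 - row Z z (2, 4) 2 * row Z z (0, 2) 3) =
      bracket Z (0, 4) *
        (row Z z (0, 4) 0 * row Z z (0, 2) 1 - row Z z (0, 2) 0 * row Z z (0, 4) 1) ∧
    bracket Z (0, 2) * (row Z z (0, 2) 2 * row Z z (2, 4) 3 - row Z z (2, 4) 2 * row Z z (0, 2) 3) =
      bracket Z (0, 4) *
        (row Z z (2, 4) 4 * row Z z (0, 4) 5 - row Z z (0, 4) 4 * row Z z (2, 4) 5) := by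
  -- The relations (0,2) − (2,4) and (0,2) − (0,4) have as minors in columns 01, 23, 45 exactly the
  -- three touching minors, because each column pair lies outside the support of one of the three
  -- propagators.
  have hd := row_sub_relation hZ z (p := (0, 2)) (q := (2, 4)) (by decide) (by decide)
  have he := row_sub_relation hZ z (p := (0, 2)) (q := (0, 4)) (by decide) (by decide)
  have s1 : ∀ a ∉ support ((0, 2) : Propagator 6), row Z z (0, 2) a = 0 :=
    fun a ha => row_of_notMem ha
  have s2 : ∀ a ∉ support ((2, 4) : Propagator 6), row Z z (2, 4) a = 0 :=
    fun a ha => row_of_notMem ha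
  have s3 : ∀ a ∉ support ((0, 4) : Propagator 6), row Z z (0, 4) a = 0 :=
    fun a ha => row_of_notMem ha
  have a4 := s1 4 (by decide)
  have a5 := s1 5 (by decide)
  have b0 := s2 0 (by decide)
  have b1 := s2 1 (by decide)
  have c2 := s3 2 (by decide)
  have c3 := s3 3 (by decide)
  rw [Fin.sum_univ_six] at hd he
  have h1 := relation_minor hd he (vol_ne_zero hZ (by decide))
  -- The same relations in cyclically shifted order, so that columns 23 are compared with 45.
  have hd' : (row Z z (0, 2) 2 - row Z z (2, 4) 2) • Z 2 +
    (row Z z (0, 2) 3 - row Z z (2, 4) 3) • Z 3 + (row Z z (0, 2) 4 - row Z z (2, 4) 4) • Z 4 +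
    (row Z z (0, 2) 5 - row Z z (2, 4) 5) • Z 5 + (row Z z (0, 2) 0 - row Z z (2, 4) 0) • Z 0 +
    (row Z z (0, 2) 1 - row Z z (2, 4) 1) • Z 1 = 0 := by rw [← hd]; abel
  have he' : (row Z z (0, 2) 2 - row Z z (0, 4) 2) • Z 2 +
    (row Z z (0, 2) 3 - row Z z (0, 4) 3) • Z 3 + (row Z z (0, 2) 4 - row Z z (0, 4) 4) • Z 4 +
    (row Z z (0, 2) 5 - row Z z (0, 4) 5) • Z 5 + (row Z z (0, 2) 0 - row Z z (0, 4) 0) • Z 0 +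
    (row Z z (0, 2) 1 - row Z z (0, 4) 1) • Z 1 = 0 := by rw [← he]; abel
  have h2 := relation_minor hd' he' (vol_ne_zero hZ (by decide))
  have e1 : vol (Z 2) (Z 3) (Z 0) (Z 1) = bracket Z (0, 2) := by
    rw [bracket_eq_vol, vol_rotate, vol_rotate, neg_neg]
    rfl
  have e2 : vol (Z 4) (Z 5) (Z 0) (Z 1) = bracket Z (0, 4) := by
    rw [bracket_eq_vol, vol_rotate, vol_rotate, neg_neg]
    rfl
  have e3 : vol (Z 0) (Z 1) (Z 4) (Z 5) = bracket Z (0, 4) := by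
    rw [bracket_eq_vol]
    rfl
  have e4 : vol (Z 2) (Z 3) (Z 4) (Z 5) = bracket Z (2, 4) := by
    rw [bracket_eq_vol]
    rfl
  rw [e3, e4, b0, b1, c2, c3] at h1
  rw [e1, e2, a4, a5, c2, c3] at h2
  constructor
  · linear_combination -h1
  · linear_combination h2

theorem residue_touch_triple (hZ : GeneralPosition Z)
    (h1 : Transversal ![(0, 2), (2, 4)] (.touch 2 0 1) Z z u)
    (h2 : Transversal ![(0, 4), (0, 2)] (.touch 0 0 1) Z z u) :
    residue φ η Z z u (![(0, 2), (2, 4)], .touch 2 0 1) +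
      residue φ η Z z u (![(0, 4), (0, 2)], .touch 0 0 1) +
      residue φ η Z z u (![(0, 4), (2, 4)], .touch 4 1 0) = 0 := by
  have i02 : Function.Injective (vertexList ((0, 2) : Propagator 6)) := by decide
  have i24 : Function.Injective (vertexList ((2, 4) : Propagator 6)) := by decide
  have i04 : Function.Injective (vertexList ((0, 4) : Propagator 6)) := by decide
  have n02 := bracket_ne_zero hZ i02
  have n24 := bracket_ne_zero hZ i24
  have n04 := bracket_ne_zero hZ i04
  have hm := touch_minors hZ
  obtain ⟨m1, m2⟩ := hm z
  have hA0 : row Z z (0, 2) 0 ≠ 0 :=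
    delta_ne_zero_of_transversal (D' := .leave 0 0) h1 (by decide) (by decide)
  have hA1 : row Z z (0, 2) 1 ≠ 0 :=
    delta_ne_zero_of_transversal (D' := .leave 0 1) h1 (by decide) (by decide)
  have hA3 : row Z z (0, 2) 3 ≠ 0 :=
    delta_ne_zero_of_transversal (D' := .leave 0 3) h1 (by decide) (by decide)
  have hB4 : row Z z (2, 4) 4 ≠ 0 :=
    delta_ne_zero_of_transversal (D' := .leave 1 4) h1 (by decide) (by decide)
  have hB5 : row Z z (2, 4) 5 ≠ 0 :=
    delta_ne_zero_of_transversal (D' := .leave 1 5) h1 (by decide) (by decide)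
  have hA2 : row Z z (0, 2) 2 ≠ 0 :=
    delta_ne_zero_of_transversal (D' := .leave 1 2) h2 (by decide) (by decide)
  have hC1 : row Z z (0, 4) 1 ≠ 0 :=
    delta_ne_zero_of_transversal (D' := .leave 0 1) h2 (by decide) (by decide)
  have hC4 : row Z z (0, 4) 4 ≠ 0 :=
    delta_ne_zero_of_transversal (D' := .leave 0 4) h2 (by decide) (by decide)
  by_cases h0 : row Z z (0, 2) 2 * row Z z (2, 4) 3 - row Z z (2, 4) 2 * row Z z (0, 2) 3 = 0
  · rw [h0, mul_zero, eq_comm, mul_eq_zero, or_iff_right n04] at m1 m2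
    rw [residue_of_eq_zero (W := ![(0, 2), (2, 4)]) (D := .touch 2 0 1) h0,
      residue_of_eq_zero (W := ![(0, 4), (0, 2)]) (D := .touch 0 0 1) m1,
      residue_of_eq_zero (W := ![(0, 4), (2, 4)]) (D := .touch 4 1 0) m2,
      deltaDeriv_touch hZ _ _ _ (lt_and_injective_of_mem _ (by decide) · |>.2),
      deltaDeriv_touch hZ _ _ _ (lt_and_injective_of_mem _ (by decide) · |>.2),
      deltaDeriv_touch hZ _ _ _ (lt_and_injective_of_mem _ (by decide) · |>.2),
      cofactor_eq (by decide)
        (l := [.leave 0 0, .leave 0 1, .leave 1 2, .leave 0 3, .leave 1 4, .leave 1 5]) (by decide),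
      cofactor_eq (by decide)
        (l := [.leave 1 0, .leave 0 1, .leave 1 2, .leave 1 3, .leave 0 4, .leave 0 5]) (by decide),
      cofactor_eq (by decide)
        (l := [.leave 0 0, .leave 0 1, .leave 1 2, .leave 1 3, .leave 0 4, .leave 1 5]) (by decide)]
    simp only [List.map_cons, List.map_nil, List.prod_cons, List.prod_nil, Move.delta,
      localized_apply, Matrix.cons_val_zero, Matrix.cons_val_one, Fin.reduceAdd, zero_add, h0, m1,
      m2, sub_zero, mul_one]
    obtain ⟨p1, p2⟩ := hm (z + u)
    obtain ⟨q1, q2⟩ := hm u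
    -- The derivative common to the three Δ, once each is weighted by the brackets of its diagram.
    set F := bracket Z (0, 2) * bracket Z (2, 4) *
      (row Z (z + u) (0, 2) 2 * row Z (z + u) (2, 4) 3 -
        row Z (z + u) (2, 4) 2 * row Z (z + u) (0, 2) 3 -
        (row Z u (0, 2) 2 * row Z u (2, 4) 3 - row Z u (2, 4) 2 * row Z u (0, 2) 3)) with hF
    have hF2 : F = bracket Z (0, 4) * bracket Z (0, 2) *
      (row Z (z + u) (0, 4) 0 * row Z (z + u) (0, 2) 1 -
        row Z (z + u) (0, 2) 0 * row Z (z + u) (0, 4) 1 -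
        (row Z u (0, 4) 0 * row Z u (0, 2) 1 - row Z u (0, 2) 0 * row Z u (0, 4) 1)) := by
      linear_combination bracket Z (0, 2) * (p1 - q1)
    have hF3 : F = bracket Z (0, 4) * bracket Z (2, 4) *
      (row Z (z + u) (2, 4) 4 * row Z (z + u) (0, 4) 5 -
        row Z (z + u) (0, 4) 4 * row Z (z + u) (2, 4) 5 -
        (row Z u (2, 4) 4 * row Z u (0, 4) 5 - row Z u (0, 4) 4 * row Z u (2, 4) 5)) := by
      linear_combination bracket Z (2, 4) * (p2 - q2)
    clear_value F
    -- The parameter is fixed by column 0, where the row of (2,4) vanishes; the polar condition then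
    -- gives column 1. The remaining difference is a relation supported on (2,4), hence zero.
    obtain ⟨l, hl⟩ : ∃ l : ℝ, l = 1 - row Z z (0, 4) 0 / row Z z (0, 2) 0 := ⟨_, rfl⟩
    have hlA : (1 - l) * row Z z (0, 2) 0 = row Z z (0, 4) 0 := by rw [hl]; field_simp; ring
    have hC : row Z z (0, 4) = (1 - l) • row Z z (0, 2) + l • row Z z (2, 4) := by
      rw [← sub_eq_zero]
      refine eq_zero_of_sum_eq_zero hZ i24 (fun a ha => ?_) ?_
      · have hB := row_of_notMem (Z := Z) (z := z) ha
        have ha' : a = 0 ∨ a = 1 :=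
          (by decide : ∀ a ∉ support ((2, 4) : Propagator 6), a = 0 ∨ a = 1) a ha
        simp only [Pi.sub_apply, Pi.add_apply, Pi.smul_apply, smul_eq_mul, hB, mul_zero, add_zero]
        rcases ha' with rfl | rfl
        · linarith
        · refine (mul_eq_zero.1 ?_).resolve_left hA0
          linear_combination -m1 - row Z z (0, 2) 1 * hlA
      · simp only [Pi.sub_apply, Pi.add_apply, Pi.smul_apply, smul_eq_mul, sub_smul, add_smul,
          Finset.sum_sub_distrib, Finset.sum_add_distrib, mul_smul, ← Finset.smul_sum,
          sum_row Z hZ z i02, sum_row Z hZ z i24, sum_row Z hZ z i04]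
        module
    have hl1 : 1 - l ≠ 0 := fun h => hC1 (by
      have := congrFun hC 1
      simpa [h, row_of_notMem (p := ((2, 4) : Propagator 6)) (a := 1) (by decide)] using this)
    have hC4' : row Z z (0, 4) 4 = l * row Z z (2, 4) 4 := by
      simpa [row_of_notMem (p := ((0, 2) : Propagator 6)) (a := 4) (by decide)] using congrFun hC 4
    have hC1' : row Z z (0, 4) 1 = (1 - l) * row Z z (0, 2) 1 := by
      simpa [row_of_notMem (p := ((2, 4) : Propagator 6)) (a := 1) (by decide)] using congrFun hC 1
    have hC5' : row Z z (0, 4) 5 = l * row Z z (2, 4) 5 := by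
      simpa [row_of_notMem (p := ((0, 2) : Propagator 6)) (a := 5) (by decide)] using congrFun hC 5
    have hl0 : l ≠ 0 := fun h => hC4 (by rw [hC4', h, zero_mul])
    have hB : ∀ a, row Z z (0, 4) a = 0 →
        row Z z (2, 4) a = -((1 - l) / l) * row Z z (0, 2) a := by
      intro a ha
      have := congrFun hC a
      simp only [ha, Pi.add_apply, Pi.smul_apply, smul_eq_mul] at this
      field_simp
      linarith
    have hB2 := hB 2 (row_of_notMem (by decide))
    have hB3 := hB 3 (row_of_notMem (by decide))
    have hN1 : numer φ η (row Z z (0, 4)) (row Z z (0, 2)) =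
        l ^ 4 • numer φ η (row Z z (0, 2)) (row Z z (2, 4)) := by
      have := numer_comb φ η (row Z z (0, 2)) (row Z z (2, 4)) (1 - l) l 1 0
      rw [← hC, one_smul, zero_smul, add_zero] at this
      rw [this]
      congr 1
      ring
    have hN2 : numer φ η (row Z z (0, 4)) (row Z z (2, 4)) =
        (1 - l) ^ 4 • numer φ η (row Z z (0, 2)) (row Z z (2, 4)) := by
      have := numer_comb φ η (row Z z (0, 2)) (row Z z (2, 4)) (1 - l) l 0 1
      rw [← hC, one_smul, zero_smul, zero_add] at this
      rw [this]
      congr 1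
      ring
    have key : ∀ x₁ x₂ x₃ : ℝ,
        x₁ = row Z z (0, 2) 0 * row Z z (0, 2) 1 * row Z z (2, 4) 2 * row Z z (0, 2) 3 *
          row Z z (2, 4) 4 * row Z z (2, 4) 5 * F →
        x₂ = row Z z (0, 2) 0 * row Z z (0, 4) 1 * row Z z (0, 2) 2 * row Z z (0, 2) 3 *
          row Z z (0, 4) 4 * row Z z (0, 4) 5 * F →
        x₃ = row Z z (0, 4) 0 * row Z z (0, 4) 1 * row Z z (2, 4) 2 * row Z z (2, 4) 3 *
          row Z z (0, 4) 4 * row Z z (2, 4) 5 * F →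
        x₁⁻¹ • numer φ η (row Z z (0, 2)) (row Z z (2, 4)) +
          x₂⁻¹ • numer φ η (row Z z (0, 4)) (row Z z (0, 2)) +
          x₃⁻¹ • numer φ η (row Z z (0, 4)) (row Z z (2, 4)) = 0 := by
      rintro _ _ _ rfl rfl rfl
      rw [hN1, hN2, smul_smul, smul_smul, ← add_smul, ← add_smul]
      convert zero_smul ℝ _
      rw [hB2, hB3, hC4', hC5', hC1', ← hlA]
      -- If `F` is 0, all three inverses are 0 by convention. Otherwise, up to a common factor, the
      -- sum is −l/(1−l) + l²/(1−l) + l = 0.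
      rcases eq_or_ne F 0 with hF0 | hF0
      · simp [hF0]
      · field_simp
        ring
    refine key _ _ _ ?_ ?_ ?_
    · rw [hF]
      ring
    · rw [hF2]
      ring
    · rw [hF3]
      ring
  · rw [residue_of_ne_zero (W := ![(0, 2), (2, 4)]) (D := .touch 2 0 1) h0,
      residue_of_ne_zero (W := ![(0, 4), (0, 2)]) (D := .touch 0 0 1),
      residue_of_ne_zero (W := ![(0, 4), (2, 4)]) (D := .touch 4 1 0), add_zero, add_zero]
    · exact fun h => (mul_ne_zero n02 h0) (m2.trans (mul_eq_zero_of_right _ h))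
    · exact fun h => (mul_ne_zero n24 h0) (m1.trans (mul_eq_zero_of_right _ h))

end Triples

/-! ### Three-term cancellation of two vertex losses and one touching -/

section SlideTouch

variable {Z : Fin 6 → Fin 4 → ℝ} {z u : Fin 4 → ℝ}
  {V : Type*} [AddCommGroup V] [Module ℝ V] {φ : Fin 2 → Fin 4 → V} {η : Fin 6 → Fin 4 → V}

theorem slides_24_13 : Slides (2, 4) (1, 3) 5 1 := by constructor <;> decide +kernel

/-- The five vectors of the propagators `(0, 2)` and `(0, 3)` satisfy one linear relation. -/
theorem row_03_sub_row_02 (hZ : GeneralPosition Z) (z : Fin 4 → ℝ) :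
    bracket Z (0, 2) * (row Z z (0, 3) 0 - row Z z (0, 2) 0) =
      bracket Z (1, 3) * row Z z (0, 3) 4 ∧
    bracket Z (0, 2) * (row Z z (0, 3) 1 - row Z z (0, 2) 1) =
      vol (Z 2) (Z 3) (Z 4) (Z 0) * row Z z (0, 3) 4 ∧
    bracket Z (0, 2) * row Z z (0, 2) 2 = -(bracket Z (0, 3) * row Z z (0, 3) 4) := by
  have h := row_sub_relation hZ z (p := (0, 3)) (q := (0, 2)) (by decide) (by decide)
  have r2 : row Z z (0, 3) 2 = 0 := row_of_notMem (by decide)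
  have r5 : row Z z (0, 3) 5 = 0 := row_of_notMem (by decide)
  have s4 : row Z z (0, 2) 4 = 0 := row_of_notMem (by decide)
  have s5 : row Z z (0, 2) 5 = 0 := row_of_notMem (by decide)
  rw [Fin.sum_univ_six, r2, r5, s4, s5] at h
  -- Each pairing kills two of the five vectors besides `Z 4` and extracts the coefficient of `Z 0`,
  -- `Z 1` or `Z 2` in terms of that of `Z 4`.
  have h1 := congrArg (vol (Z 1) (Z 2) (Z 3)) h
  have h2 := congrArg (vol (Z 0) (Z 2) (Z 3)) h
  have h3 := congrArg (vol (Z 0) (Z 1) (Z 3)) h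
  simp only [map_add, map_smul, smul_eq_mul, vol_self_first, vol_self_mid, vol_self_last, map_zero,
    mul_zero, add_zero, zero_add, sub_zero, zero_sub] at h1 h2 h3
  rw [vol_rotate] at h1
  rw [vol_swap_last (Z 0) (Z 2) (Z 1), vol_swap_mid, neg_neg,
    ← neg_neg (vol (Z 0) (Z 2) (Z 3) (Z 4)), ← vol_rotate] at h2
  rw [vol_swap_last] at h3
  simp only [bracket_eq_vol, Fin.reduceAdd, zero_add]
  refine ⟨?_, ?_, ?_⟩
  · linear_combination -h1
  · linear_combination h2
  · linear_combination h3

theorem gaugeBracket_24_5 (hZ : GeneralPosition Z) (z : Fin 4 → ℝ) :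
    gaugeBracket Z z (2, 4) 5 = bracket Z (1, 3) * row Z z (0, 2) 1 -
      vol (Z 2) (Z 3) (Z 4) (Z 0) * row Z z (0, 2) 0 := by
  have h := congrArg (vol (Z 2) (Z 3) (Z 4)) (sum_row Z hZ z (p := (0, 2)) (by decide))
  have s4 : row Z z (0, 2) 4 = 0 := row_of_notMem (by decide)
  have s5 : row Z z (0, 2) 5 = 0 := row_of_notMem (by decide)
  rw [Fin.sum_univ_six, s4, s5] at h
  simp only [map_add, map_smul, smul_eq_mul, vol_self_first, vol_self_mid,
    mul_zero, add_zero, zero_mul, map_neg] at h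
  rw [vol_rotate (Z 1)] at h
  have hg : gaugeBracket Z z (2, 4) 5 = vol (Z 2) (Z 3) (Z 4) z := by
    rw [gaugeBracket, vol_apply]
    congr 1
    ext i j
    fin_cases i <;> rfl
  rw [hg, bracket_eq_vol]
  simp only [Fin.reduceAdd]
  linarith

/-- The touching minor factors: one factor is the entry at 4, itself a polar factor and hence
nonzero under transversality; the other vanishes exactly when (2,4) loses the vertex 5. So the three
polar loci agree. -/
theorem touch_03_02 (hZ : GeneralPosition Z) (z : Fin 4 → ℝ) :
    bracket Z (0, 2) *
        (row Z z (0, 3) 0 * row Z z (0, 2) 1 - row Z z (0, 2) 0 * row Z z (0, 3) 1) =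
      row Z z (0, 3) 4 * gaugeBracket Z z (2, 4) 5 := by
  obtain ⟨h0, h1, -⟩ := row_03_sub_row_02 hZ z
  rw [gaugeBracket_24_5 hZ]
  linear_combination row Z z (0, 2) 1 * h0 - row Z z (0, 2) 0 * h1

theorem residue_slide_touch_triple (hZ : GeneralPosition Z)
    (h1 : Transversal ![(0, 2), (2, 4)] (.leave 1 5) Z z u)
    (h2 : Transversal ![(0, 3), (0, 2)] (.touch 0 0 1) Z z u) :
    residue φ η Z z u (![(0, 2), (2, 4)], .leave 1 5) +
      residue φ η Z z u (![(0, 3), (0, 2)], .touch 0 0 1) +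
      residue φ η Z z u (![(0, 3), (1, 3)], .leave 1 1) = 0 := by
  have i02 : Function.Injective (vertexList ((0, 2) : Propagator 6)) := by decide
  have i03 : Function.Injective (vertexList ((0, 3) : Propagator 6)) := by decide
  have i24 := slides_24_13.injective
  have n02 := bracket_ne_zero hZ i02
  have n03 := bracket_ne_zero hZ i03
  have n24 := bracket_ne_zero hZ i24
  have hs0 : row Z z (0, 2) 0 ≠ 0 :=
    delta_ne_zero_of_transversal (D' := .leave 0 0) h1 (by decide) (by decide)
  have hs1 : row Z z (0, 2) 1 ≠ 0 :=
    delta_ne_zero_of_transversal (D' := .leave 0 1) h1 (by decide) (by decide)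
  have hs3 : row Z z (0, 2) 3 ≠ 0 :=
    delta_ne_zero_of_transversal (D' := .leave 0 3) h1 (by decide) (by decide)
  have hT2 : row Z z (2, 4) 2 ≠ 0 :=
    delta_ne_zero_of_transversal (D' := .leave 1 2) h1 (by decide) (by decide)
  have hT4 : row Z z (2, 4) 4 ≠ 0 :=
    delta_ne_zero_of_transversal (D' := .leave 1 4) h1 (by decide) (by decide)
  have hr1 : row Z z (0, 3) 1 ≠ 0 :=
    delta_ne_zero_of_transversal (D' := .leave 0 1) h2 (by decide) (by decide)
  have hr3 : row Z z (0, 3) 3 ≠ 0 :=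
    delta_ne_zero_of_transversal (D' := .leave 0 3) h2 (by decide) (by decide)
  have hr4 : row Z z (0, 3) 4 ≠ 0 :=
    delta_ne_zero_of_transversal (D' := .leave 0 4) h2 (by decide) (by decide)
  have hmz := bracket_mul_row Z hZ z i24 slides_24_13.mem
  have hmu := bracket_mul_row Z hZ u i24 slides_24_13.mem
  have hmu' := slides_24_13.bracket_mul_row_eq hZ u
  have htz := touch_03_02 hZ z
  by_cases h0 : row Z z (2, 4) 5 = 0
  · have hm0 : gaugeBracket Z z (2, 4) 5 = 0 := by
      rw [h0, mul_zero] at hmz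
      linarith
    rw [hm0, mul_zero, mul_eq_zero, or_iff_right n02] at htz
    have hT := slides_24_13.row_eq hZ h0
    have h13 := (slides_24_13.row_eq_zero_iff hZ z).1 h0
    rw [residue_of_eq_zero (W := ![(0, 2), (2, 4)]) (D := .leave 1 5) h0,
      residue_of_eq_zero (W := ![(0, 3), (0, 2)]) (D := .touch 0 0 1) htz,
      residue_of_eq_zero (W := ![(0, 3), (1, 3)]) (D := .leave 1 1) h13,
      deltaDeriv_touch hZ _ _ _ (lt_and_injective_of_mem _ (by decide) · |>.2),
      cofactor_eq (by decide)
        (l := [.leave 0 0, .leave 0 1, .leave 1 2, .leave 0 3, .touch 2 0 1, .leave 1 4])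
        (by decide),
      cofactor_eq (by decide)
        (l := [.leave 1 0, .leave 0 1, .leave 1 2, .leave 1 3, .leave 0 3, .leave 0 4]) (by decide),
      cofactor_eq (by decide)
        (l := [.leave 0 0, .leave 0 1, .leave 1 2, .leave 0 3, .leave 1 4, .touch 3 1 0])
        (by decide)]
    simp only [List.map_cons, List.map_nil, List.prod_cons, List.prod_nil, Move.delta,
      Move.deltaDeriv, localized_apply, Matrix.cons_val_zero, Matrix.cons_val_one, Fin.reduceAdd,
      zero_add, htz, sub_zero, mul_one, ← hT]
    -- Polarization of `touch_03_02`: the bracket factor vanishes at `z`, so only its value at `u`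
    -- contributes.
    have hd : bracket Z (0, 2) *
        (row Z (z + u) (0, 3) 0 * row Z (z + u) (0, 2) 1 -
          row Z (z + u) (0, 2) 0 * row Z (z + u) (0, 3) 1 -
          (row Z u (0, 3) 0 * row Z u (0, 2) 1 - row Z u (0, 2) 0 * row Z u (0, 3) 1)) =
        row Z z (0, 3) 4 * gaugeBracket Z u (2, 4) 5 := by
      have e1 := touch_03_02 hZ (z + u)
      have e2 := touch_03_02 hZ u
      have e3 : row Z (z + u) (0, 3) 4 = row Z z (0, 3) 4 + row Z u (0, 3) 4 := by
        have := congrFun (row_add_smul hZ z u 1 i03) 4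
        simpa using this
      have e4 : gaugeBracket Z (z + u) (2, 4) 5 =
          gaugeBracket Z z (2, 4) 5 + gaugeBracket Z u (2, 4) 5 := by
        have := congrFun (row_add_smul hZ z u 1 i02)
        simp only [gaugeBracket_24_5 hZ]
        simp only [one_smul, Pi.add_apply] at this
        rw [this, this]
        ring
      rw [e3, e4, hm0] at e1
      linear_combination e1 - e2
    set m := gaugeBracket Z u (2, 4) 5
    clear_value m
    obtain ⟨k0, k1, k2⟩ := row_03_sub_row_02 hZ z
    -- Fixed by column 4, where the row of (0,2) vanishes. The difference in `hTk` is then a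
    -- relation supported on (0,2), hence zero.
    obtain ⟨k, hk⟩ : ∃ k : ℝ, k = row Z z (2, 4) 4 / row Z z (0, 3) 4 := ⟨_, rfl⟩
    have hk4 : k * row Z z (0, 3) 4 = row Z z (2, 4) 4 := by rw [hk]; field_simp
    have hTk : row Z z (2, 4) = (1 - k) • row Z z (0, 2) + k • row Z z (0, 3) := by
      rw [← sub_eq_zero]
      refine eq_zero_of_sum_eq_zero hZ i02 (fun a ha => ?_) ?_
      · have hB := row_of_notMem (Z := Z) (z := z) ha
        have ha' : a = 4 ∨ a = 5 :=
          (by decide : ∀ a ∉ support ((0, 2) : Propagator 6), a = 4 ∨ a = 5) a ha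
        simp only [Pi.sub_apply, Pi.add_apply, Pi.smul_apply, smul_eq_mul, hB, mul_zero, zero_add]
        rcases ha' with rfl | rfl
        · linarith
        · rw [h0, row_of_notMem (p := ((0, 3) : Propagator 6)) (by decide), mul_zero, sub_zero]
      · simp only [Pi.sub_apply, Pi.add_apply, Pi.smul_apply, smul_eq_mul, sub_smul, add_smul,
          Finset.sum_sub_distrib, Finset.sum_add_distrib, mul_smul, ← Finset.smul_sum,
          sum_row Z hZ z i02, sum_row Z hZ z i24, sum_row Z hZ z i03, one_smul]
        module
    have hT' : ∀ a, row Z z (2, 4) a = (1 - k) * row Z z (0, 2) a + k * row Z z (0, 3) a :=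
      fun a => congrFun hTk a
    have hk0 : k ≠ 0 := fun h => hT4 (by rw [← hk4, h, zero_mul])
    have hT0 := hT' 0
    have hT1 := hT' 1
    have hT2' := hT' 2
    have hT3 := hT' 3
    rw [row_of_notMem (by decide)] at hT0 hT1
    rw [row_of_notMem (p := ((0, 3) : Propagator 6)) (by decide), mul_zero, add_zero] at hT2'
    have hk1 : 1 - k ≠ 0 := fun h => hT2 (by rw [hT2', h, zero_mul])
    have hs0' : row Z z (0, 2) 0 = -(k / (1 - k)) * row Z z (0, 3) 0 := by
      field_simp
      linarith
    have hs1' : row Z z (0, 2) 1 = -(k / (1 - k)) * row Z z (0, 3) 1 := by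
      field_simp
      linarith
    have hr0 : row Z z (0, 3) 0 ≠ 0 := fun h => hs0 (by rw [hs0', h, mul_zero])
    have hs2 : row Z z (0, 2) 2 ≠ 0 := fun h => hT2 (by rw [hT2', h, mul_zero])
    have hN1 : numer φ η (row Z z (0, 2)) (row Z z (2, 4)) =
        k ^ 4 • numer φ η (row Z z (0, 2)) (row Z z (0, 3)) := by
      have := numer_comb φ η (row Z z (0, 2)) (row Z z (0, 3)) 1 0 (1 - k) k
      rw [← hTk, one_smul, zero_smul, add_zero] at this
      rw [this]
      congr 1
      ring
    have hN2 : numer φ η (row Z z (0, 3)) (row Z z (2, 4)) =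
        (1 - k) ^ 4 • numer φ η (row Z z (0, 2)) (row Z z (0, 3)) := by
      have := numer_comb φ η (row Z z (0, 2)) (row Z z (0, 3)) 0 1 (1 - k) k
      rw [← hTk, one_smul, zero_smul, zero_add] at this
      rw [this]
      congr 1
      ring
    have key : ∀ x₁ x₂ x₃ : ℝ,
        x₁ = -(bracket Z (0, 2) * (row Z z (0, 2) 0 * row Z z (0, 2) 1 * row Z z (2, 4) 2 *
          row Z z (0, 2) 3 * (row Z z (0, 2) 2 * row Z z (2, 4) 3 -
            row Z z (2, 4) 2 * row Z z (0, 2) 3) * row Z z (2, 4) 4) * m) →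
        x₂ = bracket Z (0, 3) * (row Z z (0, 2) 0 * row Z z (0, 3) 1 * row Z z (0, 2) 2 *
          row Z z (0, 2) 3 * row Z z (0, 3) 3 * row Z z (0, 3) 4) * row Z z (0, 3) 4 * m →
        x₃ = bracket Z (0, 3) * (row Z z (0, 3) 0 * row Z z (0, 3) 1 * row Z z (2, 4) 2 *
          row Z z (0, 3) 3 * row Z z (2, 4) 4 * (row Z z (2, 4) 3 * row Z z (0, 3) 4 -
            row Z z (0, 3) 3 * row Z z (2, 4) 4)) * m →
        x₁⁻¹ • numer φ η (row Z z (0, 2)) (row Z z (2, 4)) +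
          x₂⁻¹ • numer φ η (row Z z (0, 3)) (row Z z (0, 2)) +
          x₃⁻¹ • numer φ η (row Z z (0, 3)) (row Z z (2, 4)) = 0 := by
      intro x₁ x₂ x₃ e1 e2 e3
      rw [hN1, hN2, numer_swap, smul_smul, smul_smul, ← add_smul, ← add_smul]
      convert zero_smul ℝ _
      -- All denominators are brought to one common monomial; `k2` trades the bracket of (0,3) times
      -- the entry at 4 for the bracket of (0,2). With numerator weights k⁴, 1, (1−k)⁴ the sum is
      -- proportional to −(1−k) + (1−k)/k − (1−k)²/k = 0.
      have f1 : x₁ = bracket Z (0, 2) * m * k ^ 4 / (1 - k) * row Z z (0, 3) 0 *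
          row Z z (0, 3) 1 * row Z z (0, 2) 2 ^ 2 * row Z z (0, 2) 3 * row Z z (0, 3) 3 *
          row Z z (0, 3) 4 * -1 := by
        rw [e1, hT2', hT3, ← hk4, hs0', hs1']
        field_simp
        ring
      have f2 : x₂ = bracket Z (0, 2) * m * k / (1 - k) * row Z z (0, 3) 0 *
          row Z z (0, 3) 1 * row Z z (0, 2) 2 ^ 2 * row Z z (0, 2) 3 * row Z z (0, 3) 3 *
          row Z z (0, 3) 4 := by
        rw [e2, hs0']
        linear_combination (k / (1 - k)) * (row Z z (0, 3) 0 * row Z z (0, 3) 1 *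
          row Z z (0, 2) 2 * row Z z (0, 2) 3 * row Z z (0, 3) 3 * row Z z (0, 3) 4 * m) * -k2
      have f3 : x₃ = -bracket Z (0, 2) * m * k * (1 - k) ^ 2 * row Z z (0, 3) 0 *
          row Z z (0, 3) 1 * row Z z (0, 2) 2 ^ 2 * row Z z (0, 2) 3 * row Z z (0, 3) 3 *
          row Z z (0, 3) 4 := by
        rw [e3, hT2', hT3, ← hk4]
        linear_combination (k * (1 - k) ^ 2) * (row Z z (0, 3) 0 * row Z z (0, 3) 1 *
          row Z z (0, 2) 2 * row Z z (0, 2) 3 * row Z z (0, 3) 3 * row Z z (0, 3) 4 * m) * k2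
      rw [f1, f2, f3]
      rcases eq_or_ne m 0 with hm | hm
      · simp [hm]
      · field_simp
        ring
    refine key _ _ _ ?_ ?_ ?_
    · linear_combination bracket Z (0, 2) * (row Z z (0, 2) 0 * row Z z (0, 2) 1 * row Z z (2, 4) 2 *
          row Z z (0, 2) 3 * (row Z z (0, 2) 2 * row Z z (2, 4) 3 -
            row Z z (2, 4) 2 * row Z z (0, 2) 3) * row Z z (2, 4) 4) * hmu
    · linear_combination bracket Z (0, 3) * (row Z z (0, 2) 0 * row Z z (0, 3) 1 * row Z z (0, 2) 2 *
          row Z z (0, 2) 3 * row Z z (0, 3) 3 * row Z z (0, 3) 4) * hd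
    · linear_combination bracket Z (0, 3) * (row Z z (0, 3) 0 * row Z z (0, 3) 1 *
          row Z z (2, 4) 2 * row Z z (0, 3) 3 * row Z z (2, 4) 4 * (row Z z (2, 4) 3 *
            row Z z (0, 3) 4 - row Z z (0, 3) 3 * row Z z (2, 4) 4)) * (hmu' - hmu)
  · have htz' : row Z z (0, 3) 0 * row Z z (0, 2) 1 - row Z z (0, 2) 0 * row Z z (0, 3) 1 ≠ 0 := by
      intro h
      rw [h, mul_zero, eq_comm, mul_eq_zero, or_iff_right hr4] at htz
      rw [htz, neg_zero, mul_eq_zero, or_iff_right n24] at hmz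
      exact h0 hmz
    rw [residue_of_ne_zero (W := ![(0, 2), (2, 4)]) (D := .leave 1 5) h0,
      residue_of_ne_zero (W := ![(0, 3), (0, 2)]) (D := .touch 0 0 1) htz',
      residue_of_ne_zero (W := ![(0, 3), (1, 3)]) (D := .leave 1 1)
        ((slides_24_13.row_eq_zero_iff hZ z).not.1 h0), add_zero, add_zero]

end SlideTouch

/-! ### Cancellation of the residues -/

section Cancellation

variable {Z : Fin 6 → Fin 4 → ℝ} {z u : Fin 4 → ℝ} {V : Type*} [AddCommGroup V] [Module ℝ V]
  {φ : Fin 2 → Fin 4 → V} {η : Fin 6 → Fin 4 → V}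

theorem sum_residue_representative (hZ : GeneralPosition Z)
    {o : List (Diagram 2 6 × Move 2 6) × List (Fin 6 × Bool)} (ho : o ∈ orbitTable)
    (htr : ∀ x ∈ o.1, Transversal x.1 x.2 Z z u) :
    (o.1.map (residue φ η Z z u)).sum = 0 := by
  simp only [orbitTable, List.mem_cons, List.not_mem_nil, or_false] at ho
  rcases ho with rfl | rfl | rfl | rfl | rfl | rfl | rfl | rfl <;>
    simp only [List.mem_cons, List.not_mem_nil, or_false, forall_eq_or_imp, forall_eq] at htr <;>
    simp only [List.map_cons, List.map_nil, List.sum_cons, List.sum_nil, add_zero, ← add_assoc]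
  · exact residue_touch_triple hZ htr.1 htr.2.1
  · exact residue_slide_touch_triple hZ htr.1 htr.2.1
  · exact residue_02_24_add_02_35 hZ
  · exact residue_02_24_add_25_24 hZ
  · exact residue_02_35_add_25_35 hZ
  · exact residue_02_25_add_15_25 hZ
  · exact residue_eq_zero_of_touch (e := 2) hZ (by decide +kernel) htr (by decide +kernel)
      (by decide +kernel)
  · exact residue_eq_zero_of_touch (e := 2) hZ (by decide +kernel) htr (by decide +kernel)
      (by decide +kernel)

theorem GeneralPosition.comp_actVertex (hZ : GeneralPosition Z) (g : Fin 6 × Bool) :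
    GeneralPosition (Z ∘ actVertex g) :=
  fun s hs => hZ (actVertex g ∘ s) ((actVertex_injective g).comp hs)

theorem act_mem_cancellingSets {o : List (Diagram 2 6 × Move 2 6) × List (Fin 6 × Bool)}
    (ho : o ∈ orbitTable) {g : Fin 6 × Bool} (hg : g ∈ o.2) :
    o.1.map (act g) ∈ cancellingSets :=
  List.mem_flatMap.2 ⟨o, ho, List.mem_map_of_mem hg⟩

theorem boundaries_actDiagram {o : List (Diagram 2 6 × Move 2 6) × List (Fin 6 × Bool)}
    (ho : o ∈ orbitTable) {g : Fin 6 × Bool} (hg : g ∈ o.2) {x : Diagram 2 6 × Move 2 6}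
    (hx : x ∈ o.1) :
    boundaries (actDiagram g x.1) = (boundaries x.1).image (actMove g (rowSwap g x.1)) := by
  have hW := (mem_of_mem_representative o ho x hx).1
  have hW' : actDiagram g x.1 ∈ admissibleList :=
    (mem_of_mem_cancellingSets _ (act_mem_cancellingSets ho hg) _ (List.mem_map_of_mem hx)).1
  obtain ⟨h1, h2⟩ := actMove_mem o ho g hg x hx
  rw [boundaries_eq hW, boundaries_eq hW', eq_comm]
  refine Finset.eq_of_subset_of_card_le (fun D hD => ?_) ?_
  · obtain ⟨D', hD', rfl⟩ := Finset.mem_image.1 hD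
    exact List.mem_toFinset.2 (h1 D' (List.mem_toFinset.1 hD'))
  · rw [Finset.card_image_of_injective _ (actMove_injective g (rowSwap_injective g x.1)),
      List.toFinset_card_of_nodup (moveList_nodup _ hW),
      List.toFinset_card_of_nodup (moveList_nodup _ hW'), h2]

theorem sum_residue_eq_zero (hZ : GeneralPosition Z) {c : List (Diagram 2 6 × Move 2 6)}
    (hc : c ∈ cancellingSets) (htr : ∀ x ∈ c, Transversal x.1 x.2 Z z u) :
    (c.map (residue φ η Z z u)).sum = 0 := by
  obtain ⟨o, ho, hc⟩ := List.mem_flatMap.1 hc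
  obtain ⟨g, hg, rfl⟩ := List.mem_map.1 hc
  have hW := fun x hx => lt_and_injective_of_mem _ (mem_of_mem_representative o ho x hx).1
  rw [List.map_map, ← sum_residue_representative (φ := φ) (η := η ∘ actVertex g)
    (hZ.comp_actVertex g) ho (z := z) (u := u)]
  · congr 1
    exact List.map_congr_left fun x hx => residue_act Z z u g φ η (fun b => (hW x hx b).1)
      (fun b => (hW x hx b).2) (boundaries_actDiagram ho hg hx)
  · exact fun x hx => transversal_of_act Z z u g (fun b => (hW x hx b).1)
      (fun b => (hW x hx b).2) (boundaries_actDiagram ho hg hx) (htr _ (List.mem_map_of_mem hx))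

/-! ### From the cancelling sets to the sum over one positroid cell -/

theorem boundaryBases_eq {c : List (Diagram 2 6 × Move 2 6)} (hc : c ∈ cancellingSets)
    {x y : Diagram 2 6 × Move 2 6} (hx : x ∈ c) (hy : y ∈ c) :
    boundaryBases x.1 x.2 = boundaryBases y.1 y.2 := by
  have hD : ∀ x ∈ c, ∀ e a b, x.2 = .touch e a b → a ≠ b := by
    rintro x hx e a b h rfl
    obtain ⟨h1, h2⟩ := mem_of_mem_cancellingSets c hc x hx
    exact touch_ne _ h1 _ h2 e a h
  ext I
  rw [mem_boundaryBases_iff (hD x hx), mem_boundaryBases_iff (hD y hy)]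
  exact isMoveBasis_iff c hc x hx y hy _ _ (I.strictMono (by decide))

theorem mem_contributions {k n : ℕ} [NeZero n] {B : Set (Fin k ↪o Fin n)}
    {x : Diagram k n × Move k n} : x ∈ contributions B ↔
      Admissible x.1 ∧ x.2 ∈ boundaries x.1 ∧ boundaryBases x.1 x.2 = B := by
  simp [contributions]

open Classical in
theorem contributions_eq (B : Set (Fin 2 ↪o Fin 6)) : contributions B =
    cancellingSets.flatten.toFinset.filter fun x => boundaryBases x.1 x.2 = B := by
  ext x
  simp only [mem_contributions, Finset.mem_filter, List.mem_toFinset, ← and_assoc]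
  refine and_congr_left fun _ => ⟨fun h => ?_, fun h => ?_⟩
  · have hW := mem_admissibleList h.1
    exact mem_flatten_cancellingSets _ hW _ ((mem_boundaries_iff hW).1 h.2)
  · obtain ⟨c, hc, hx⟩ := List.mem_flatten.1 h
    obtain ⟨h1, h2⟩ := mem_of_mem_cancellingSets c hc x hx
    exact ⟨admissible_of_mem _ h1, (mem_boundaries_iff h1).2 h2⟩

theorem sum_contributions_residue (hZ : GeneralPosition Z) (B : Set (Fin 2 ↪o Fin 6))
    (htr : ∀ x ∈ contributions B, Transversal x.1 x.2 Z z u) :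
    ∑ x ∈ contributions B, residue φ η Z z u x = 0 := by
  classical
  rw [contributions_eq] at htr ⊢
  rw [Finset.sum_filter, List.sum_toFinset _ nodup_flatten_cancellingSets, List.map_flatten,
    List.sum_flatten]
  refine List.sum_eq_zero fun s hs => ?_
  simp only [List.map_map, List.mem_map, Function.comp_apply] at hs
  obtain ⟨c, hc, rfl⟩ := hs
  -- The positroid is constant on `c`, so `c` contributes either entirely or not at all.
  by_cases h : ∃ x ∈ c, boundaryBases x.1 x.2 = B
  · obtain ⟨x, hx, hB⟩ := h
    have hB' : ∀ y ∈ c, boundaryBases y.1 y.2 = B := fun y hy =>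
      (boundaryBases_eq hc hy hx).trans hB
    rw [List.map_congr_left fun y hy => if_pos (hB' y hy)]
    refine sum_residue_eq_zero hZ hc fun y hy => htr y ?_
    exact Finset.mem_filter.2 ⟨List.mem_toFinset.2 (List.mem_flatten.2 ⟨c, hc, hy⟩), hB' y hy⟩
  · push Not at h
    refine List.sum_eq_zero fun s hs => ?_
    obtain ⟨y, hy, rfl⟩ := List.mem_map.1 hs
    exact if_neg (h y hy)

end Cancellation
end WilsonLoop

theorem mainTheorem3 {V : Type*} [AddCommGroup V] [Module ℝ V]
    -- external data: twistor components `Z`, fermionic components `η`, auxiliary variables `φ`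
    (Z : Fin 6 → Fin 4 → ℝ) (hZ : WilsonLoop.GeneralPosition Z)
    (η : Fin 6 → Fin 4 → V) (φ : Fin 2 → Fin 4 → V)
    -- an admissible diagram
    (W : WilsonLoop.Diagram 2 6) (hW : WilsonLoop.Admissible W)
    -- a 5-dimensional positroid cell on the boundary of the cell of `W`
    (B : Set (Fin 2 ↪o Fin 6)) (hB : WilsonLoop.IsPositroid B) (hdim : WilsonLoop.CellHasDim B 5)
    (hbd : WilsonLoop.positroidCell B ⊆
      WilsonLoop.closedCell W \ WilsonLoop.positroidCell (WilsonLoop.bases W))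
    -- a line of gauge vectors that crosses the polar loci in a generic way
    (z u : Fin 4 → ℝ)
    (htr : ∀ x ∈ WilsonLoop.contributions B, WilsonLoop.Transversal x.1 x.2 Z z u) :
    ∃ r : WilsonLoop.Diagram 2 6 × WilsonLoop.Move 2 6 → ExteriorAlgebra ℝ V,
      (∀ x ∈ WilsonLoop.contributions B,
        WilsonLoop.HasSimpleResidue
          (fun t => WilsonLoop.integral x.1 φ η Z (z + t • u)) (r x)) ∧
      ∑ x ∈ WilsonLoop.contributions B, r x = 0 := by
  refine ⟨WilsonLoop.residue φ η Z z u, ?_, WilsonLoop.sum_contributions_residue hZ B htr⟩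
  simp only [WilsonLoop.mem_contributions] at htr ⊢
  refine fun x hx => ?_
  have hp := fun b => (WilsonLoop.lt_and_injective_of_mem _
    (WilsonLoop.mem_admissibleList hx.1) b).2
  exact WilsonLoop.hasSimpleResidue_integral φ η hZ hp hx.2.1
    (WilsonLoop.denom_eq_prod_boundaries hp) (htr x hx)
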